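/- **Theorem 3.1.** Let $\mathbb D$ be the open unit disk. A finite Blaschke product of order $n\ge 1$ is a map $z\mapsto \lambda\prod_{j=1}^n \frac{z-\alpha_j}{1-\overline{\alpha_j}z}$ of $\mathbb D$ onto itself, with $|\lambda|=1$ and $\alpha_1,\dots,\alpha_n\in\mathbb D$. Let $I$ be a finite Blaschke product of order $n$ with $I(0)=0$ all of whose zeros in $\mathbb D$ are simple. Then $I^{-1}$ has exactly $n$ branches at $0$, that is, there are exactly $n$ germs $g$ at $0$ of analytic functions with $g(0)\in\mathbb D$ and $I\circ g=\mathrm{id}$ near $0$. Let $G_I$ be the group of permutations of these branches produced by analytic continuation along loops based at $0$ in $\mathbb D\setminus\{I(z): z\in\mathbb D,\ I'(z)=0\}$. The group $G_I$ respects a partition $\mathcal P$ of the set of branches if every element of $G_I$ maps every block of $\mathcal P$ onto a block of $\mathcal P$; the order of $\mathcal P$ is $k$ if every block has exactly $k$ elements. For a partition $\mathcal P$ that $G_I$ respects, let $\mathcal P_0$ be the block containing the branch that vanishes at $0$ and put $$b_{\mathcal P}(z)=\lambda_{\mathcal P}\prod_{g\in\mathcal P_0}\frac{z-g(0)}{1-\overline{g(0)}\,z},$$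 where $|\lambda_{\mathcal P}|=1$ is chosen so that $b_{\mathcal P}'(0)>0$. For a finite Blaschke product $b$, let $\mathcal P_b$ be the partition of the branches in which $g$ and $h$ lie in the same block if and only if $b\circ g=b\circ h$ near $0$. 1. If $\mathcal P$ is a partition of the branches that $G_I$ respects, then all blocks of $\mathcal P$ have the same number of elements, $b_{\mathcal P}$ is a finite Blaschke product whose order is the order of $\mathcal P$, with $b_{\mathcal P}(0)=0$ and $b_{\mathcal P}'(0)>0$, and there is a finite Blaschke product $J_{\mathcal P}$ such that $I=J_{\mathcal P}\circ b_{\mathcal P}$ on $\mathbb D$. 2. Conversely, if $J$ and $b$ are finite Blaschke products such that $I=J\circ b$ on $\mathbb D$, then $G_I$ respects the partition $\mathcal P_b$, and the order of $\mathcal P_b$ is the order of $b$. 3. Moreover, $\mathcal P_{b_{\mathcal P}}=\mathcal P$ for every partition $\mathcal P$ that $G_I$ respects. If $I=J\circ b$ with finite Blaschke products $J$ and $b$, then $b=\varphi\circ b_{\mathcal P_b}$ on $\mathbb D$ for some finite Blaschke product $\varphi$ of order $1$ (a conformal automorphism of $\mathbb D$), and $b_{\mathcal P_b}=b$ on $\mathbb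 D$ if $b$ is normalized by $b(0)=0$ and $b'(0)>0$. -/

import Mathlib

open Set Filter Topology Metric

noncomputable section

/-- `f` agrees on the open unit disk with a finite Blaschke product of (positive) order `n`.
Only the values of `f` on the disk matter. -/
def IsFiniteBlaschke (n : ℕ) (f : ℂ → ℂ) : Prop :=
  0 < n ∧ ∃ (c : ℂ) (a : Fin n → ℂ), ‖c‖ = 1 ∧ (∀ j, a j ∈ ball (0 : ℂ) 1) ∧
    ∀ z ∈ ball (0 : ℂ) 1,
      f z = c * ∏ j, (z - a j) / (1 - (starRingEnd ℂ) (a j) * z)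

/-- The conditions `f(0) = 0` and `f'(0) > 0`. -/
def VanishesWithPosDeriv (f : ℂ → ℂ) : Prop :=
  f 0 = 0 ∧ 0 < (deriv f 0).re ∧ (deriv f 0).im = 0

/-- The critical values in the disk of a function on the disk. -/
def diskCriticalValues (I : ℂ → ℂ) : Set ℂ :=
  {w | ∃ z ∈ ball (0 : ℂ) 1, deriv I z = 0 ∧ I z = w}

/-- The branches of `I⁻¹` at `0`: germs at `0` of analytic functions `f` with values in the disk
such that `I (f w) = w` for `w` near `0`. -/
def InvBranch (I : ℂ → ℂ) : Type :=
  {g : Germ (𝓝 (0 : ℂ)) ℂ // ∃ f : ℂ → ℂ, AnalyticAt ℂ f 0 ∧ f 0 ∈ ball (0 : ℂ) 1 ∧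
    (∀ᶠ w in 𝓝 (0 : ℂ), I (f w) = w) ∧ g = (f : Germ (𝓝 (0 : ℂ)) ℂ)}

/-- The value at `0` of a branch. -/
def InvBranch.value {I : ℂ → ℂ} (g : InvBranch I) : ℂ := Germ.value g.1

/-- The germ at `0` of the composition of `b` with a branch. -/
def InvBranch.comp {I : ℂ → ℂ} (b : ℂ → ℂ) (g : InvBranch I) : Germ (𝓝 (0 : ℂ)) ℂ :=
  Germ.map b g.1

/-- The germ `h` at the endpoint of `γ` is obtained from the germ `g` at its starting point by
analytic continuation along `γ`: there are functions `F t` analytic at `γ t`, where `F s` and `F t`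
have the same germ at `γ s` for `s` close to `t`, which start with `g` and end with `h`. -/
def ContinuesAlong {x y : ℂ} (γ : Path x y) (g : Germ (𝓝 x) ℂ) (h : Germ (𝓝 y) ℂ) : Prop :=
  ∃ F : unitInterval → ℂ → ℂ,
    (∀ t, AnalyticAt ℂ (F t) (γ t)) ∧
    (∀ t, ∀ᶠ s in 𝓝 t, F s =ᶠ[𝓝 (γ s)] F t) ∧
    g = (F 0 : Germ (𝓝 x) ℂ) ∧ h = (F 1 : Germ (𝓝 y) ℂ)

/-- The permutation `σ` of the branches of `I⁻¹` at `0` is produced by analytic continuation along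
one loop based at `0` in the disk with the critical values of `I` removed. -/
def IsLoopPerm (I : ℂ → ℂ) (σ : Equiv.Perm (InvBranch I)) : Prop :=
  ∃ γ : Path (0 : ℂ) 0, (∀ t, γ t ∈ ball (0 : ℂ) 1 \ diskCriticalValues I) ∧
    ∀ g : InvBranch I, ContinuesAlong γ g.1 (σ g).1

/-- The group `G_I` of the permutations of the branches produced by loops. -/
def branchGroup (I : ℂ → ℂ) : Subgroup (Equiv.Perm (InvBranch I)) :=
  Subgroup.closure {σ | IsLoopPerm I σ}

/-- `P` is a partition of the set of branches which `G_I` respects: each element of `G_I` maps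
blocks of `P` onto blocks of `P`. -/
def IsRespectedPartition (I : ℂ → ℂ) (P : Set (Set (InvBranch I))) : Prop :=
  Setoid.IsPartition P ∧ ∀ σ ∈ branchGroup I, ∀ A ∈ P, σ '' A ∈ P

/-- The partition `P` has order `k`: each of its blocks has exactly `k` elements. -/
def HasPartitionOrder {I : ℂ → ℂ} (P : Set (Set (InvBranch I))) (k : ℕ) : Prop :=
  ∀ A ∈ P, A.Finite ∧ A.ncard = k

/-- The partition `P_b`: two branches `g`, `h` are in the same block iff `b ∘ g = b ∘ h`. -/
def partitionOf (I b : ℂ → ℂ) : Set (Set (InvBranch I)) :=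
  {A | ∃ g : InvBranch I, A = {h | h.comp b = g.comp b}}

/-- The block of `P` which contains the branch with value `0` at `0`. -/
def zeroBlock {I : ℂ → ℂ} (P : Set (Set (InvBranch I))) : Set (InvBranch I) :=
  {h | ∃ A ∈ P, h ∈ A ∧ ∃ g ∈ A, g.value = 0}

/-- The Blaschke product with leading constant `1` whose zeros are the values at `0` of the
branches in the block containing the branch with value `0`. -/
def monicBlaschkeOf {I : ℂ → ℂ} (P : Set (Set (InvBranch I))) (z : ℂ) : ℂ :=
  ∏ᶠ h ∈ zeroBlock P, (z - h.value) / (1 - (starRingEnd ℂ) h.value * z)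

/-- The Blaschke product `b_P`: the rotation of the preceding one with positive derivative
at `0`. -/
def blaschkeOf {I : ℂ → ℂ} (P : Set (Set (InvBranch I))) (z : ℂ) : ℂ :=
  (starRingEnd ℂ) (deriv (monicBlaschkeOf P) 0) / (‖deriv (monicBlaschkeOf P) 0‖ : ℂ) *
    monicBlaschkeOf P z

end

/-! Let `f` be the given product. Its critical values in the disk are finitely many, and over the
others `f` is a covering whose fibres have as many points as `f` has zeros. Simplicity of the zeros
makes 0 a regular value, so a branch is the same thing as its value at 0, a zero of `f`, and
continuation along loops becomes path lifting (`exists_lift`, `exists_isLoopPerm`).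

A respected partition is therefore an equivalence relation on the zeros that is invariant under
monodromy. Carrying it along paths of pairs of points in a common fibre gives a locally constant
equivalence relation on all regular fibres (`isFiberRel_continuedRel`). The right factor is, up to a
constant, the product `b z` of all points of the class of `z` (`classProd`). It is holomorphic and
bounded by 1. By Vieta the product of the whole fibre has modulus `‖f z‖`, so `‖f‖ ≤ ‖b‖ ≤ 1`.

The main tool is a squeezing lemma, `exists_isBlaschkeWith_of_blaschkeProd_le`: a holomorphic
function whose modulus lies between that of a finite Blaschke product and 1 is itself a finite
Blaschke product, with zeros among the given ones. It follows from Schwarz-Pick by dividing out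
zeros, and needs no boundary values. It applies to `b`, whose zeros are the class of 0. Thus the
degree of `b` equals the size of the classes, so its fibres through regular points are exactly the
classes. Hence `f` is constant on the fibres of `b`, and `exists_factor` produces the left factor,
by squeezing again.

Conversely, let `f = J ∘ b`. For a branch `g`, the germ `b ∘ g` is a local inverse of `J`, hence
determined by `b (g 0)`. Equality of two such germs persists under continuation, so the partition is
respected, and its blocks are counted by fibres of `b`. Finally, `b` followed by the automorphism
sending `b 0` to 0 is squeezed between `f` and 1, and its zeros are the values of the zero block. So
it is the product built from the partition, up to a unimodular constant. -/

noncomputable section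

open scoped ComplexConjugate
open Polynomial

/-! ### Blaschke factors and finite Blaschke products -/

/-- The Blaschke factor with zero `a`. -/
def blaschkeFactor (a z : ℂ) : ℂ := (z - a) / (1 - (starRingEnd ℂ) a * z)

/-- The Blaschke product with leading constant `1` and the multiset `s` of zeros. -/
def blaschkeProd (s : Multiset ℂ) (z : ℂ) : ℂ := (s.map fun a => blaschkeFactor a z).prod

/-- On the disk, `f` is `c` times the Blaschke product with zeros `s`. -/
structure IsBlaschkeWith (c : ℂ) (s : Multiset ℂ) (f : ℂ → ℂ) : Prop where
  norm_const : ‖c‖ = 1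
  zeros_mem : ∀ a ∈ s, a ∈ ball (0 : ℂ) 1
  eq_on : ∀ z ∈ ball (0 : ℂ) 1, f z = c * blaschkeProd s z

theorem one_sub_conj_mul_ne_zero {a z : ℂ} (ha : a ∈ ball (0 : ℂ) 1) (hz : ‖z‖ ≤ 1) :
    1 - conj a * z ≠ 0 := by
  intro h
  have h1 : ‖conj a * z‖ = 1 := by rw [← sub_eq_zero.mp h]; simp
  rw [norm_mul, RCLike.norm_conj] at h1
  rw [mem_ball_zero_iff] at ha
  nlinarith [norm_nonneg a, norm_nonneg z]

/-- The sign of the right side decides whether a Blaschke factor has modulus below or above 1, so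
this one identity serves both inside and outside the disk. -/
theorem normSq_blaschke_identity (a z : ℂ) :
    ‖1 - conj a * z‖ ^ 2 - ‖z - a‖ ^ 2 = (1 - ‖a‖ ^ 2) * (1 - ‖z‖ ^ 2) := by
  simp only [← Complex.normSq_eq_norm_sq, Complex.normSq_apply]
  simp
  ring

theorem norm_blaschkeFactor_lt_one {a z : ℂ} (ha : a ∈ ball (0 : ℂ) 1)
    (hz : z ∈ ball (0 : ℂ) 1) : ‖blaschkeFactor a z‖ < 1 := by
  have h0 := one_sub_conj_mul_ne_zero ha (mem_ball_zero_iff.mp hz).le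
  rw [mem_ball_zero_iff] at ha hz
  rw [blaschkeFactor, norm_div, div_lt_one (norm_pos_iff.mpr h0)]
  have h := normSq_blaschke_identity a z
  have h1 : 0 < (1 - ‖a‖ ^ 2) * (1 - ‖z‖ ^ 2) := by
    apply mul_pos <;> nlinarith [norm_nonneg a, norm_nonneg z]
  exact lt_of_pow_lt_pow_left₀ 2 (norm_nonneg _) (by linarith)

theorem blaschkeFactor_eq_zero_iff {a z : ℂ} (ha : a ∈ ball (0 : ℂ) 1)
    (hz : z ∈ ball (0 : ℂ) 1) : blaschkeFactor a z = 0 ↔ z = a := by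
  have h0 := one_sub_conj_mul_ne_zero ha (mem_ball_zero_iff.mp hz).le
  simp [blaschkeFactor, div_eq_zero_iff, h0, sub_eq_zero]

theorem differentiableOn_blaschkeFactor {a : ℂ} (ha : a ∈ ball (0 : ℂ) 1) :
    DifferentiableOn ℂ (blaschkeFactor a) (ball 0 1) := by
  intro z hz
  have h0 := one_sub_conj_mul_ne_zero ha (mem_ball_zero_iff.mp hz).le
  unfold blaschkeFactor
  exact DifferentiableWithinAt.div (by fun_prop) (by fun_prop) h0

theorem blaschkeFactor_neg_comp {a z : ℂ} (ha : a ∈ ball (0 : ℂ) 1)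
    (hz : z ∈ ball (0 : ℂ) 1) : blaschkeFactor (-a) (blaschkeFactor a z) = z := by
  have h0 := one_sub_conj_mul_ne_zero ha (mem_ball_zero_iff.mp hz).le
  have h1 := one_sub_conj_mul_ne_zero ha (mem_ball_zero_iff.mp ha).le
  have h2 : 1 - conj (-a) * ((z - a) / (1 - conj a * z)) =
      (1 - conj a * a) / (1 - conj a * z) := by
    rw [map_neg]; field_simp; ring
  have h3 : (z - a) / (1 - conj a * z) - -a = z * (1 - conj a * a) / (1 - conj a * z) := by
    rw [sub_neg_eq_add, div_add' _ _ _ h0]; congr 1; ring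
  unfold blaschkeFactor
  rw [h2, h3, div_div_div_cancel_right₀ h0, mul_div_assoc, div_self h1, mul_one]

theorem neg_mem_unit_ball {a : ℂ} (ha : a ∈ ball (0 : ℂ) 1) : -a ∈ ball (0 : ℂ) 1 := by
  simpa using ha

theorem blaschkeFactor_mem_ball {a z : ℂ} (ha : a ∈ ball (0 : ℂ) 1)
    (hz : z ∈ ball (0 : ℂ) 1) : blaschkeFactor a z ∈ ball (0 : ℂ) 1 :=
  mem_ball_zero_iff.mpr (norm_blaschkeFactor_lt_one ha hz)

@[simp] theorem blaschkeProd_zero (z : ℂ) : blaschkeProd 0 z = 1 := by simp [blaschkeProd]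

@[simp] theorem blaschkeProd_cons (a : ℂ) (s : Multiset ℂ) (z : ℂ) :
    blaschkeProd (a ::ₘ s) z = blaschkeFactor a z * blaschkeProd s z := by simp [blaschkeProd]

theorem norm_blaschkeProd_le_one {s : Multiset ℂ} (hs : ∀ a ∈ s, a ∈ ball (0 : ℂ) 1) {z : ℂ}
    (hz : z ∈ ball (0 : ℂ) 1) : ‖blaschkeProd s z‖ ≤ 1 := by
  induction s using Multiset.induction_on with
  | empty => simp
  | cons a s ih =>
    rw [blaschkeProd_cons, norm_mul]
    exact mul_le_one₀ (norm_blaschkeFactor_lt_one (hs a (by simp)) hz).le (norm_nonneg _)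
      (ih fun b hb => hs b (by simp [hb]))

theorem norm_blaschkeProd_lt_one {s : Multiset ℂ} (hs : ∀ a ∈ s, a ∈ ball (0 : ℂ) 1)
    (h0 : s ≠ 0) {z : ℂ} (hz : z ∈ ball (0 : ℂ) 1) : ‖blaschkeProd s z‖ < 1 := by
  obtain ⟨a, ha⟩ := Multiset.exists_mem_of_ne_zero h0
  obtain ⟨t, rfl⟩ := Multiset.exists_cons_of_mem ha
  rw [blaschkeProd_cons, norm_mul]
  exact mul_lt_one_of_nonneg_of_lt_one_left (norm_nonneg _)
    (norm_blaschkeFactor_lt_one (hs a (by simp)) hz)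
    (norm_blaschkeProd_le_one (fun b hb => hs b (by simp [hb])) hz)

theorem blaschkeProd_eq_zero_iff {s : Multiset ℂ} (hs : ∀ a ∈ s, a ∈ ball (0 : ℂ) 1) {z : ℂ}
    (hz : z ∈ ball (0 : ℂ) 1) : blaschkeProd s z = 0 ↔ z ∈ s := by
  rw [blaschkeProd, Multiset.prod_eq_zero_iff, Multiset.mem_map]
  constructor
  · rintro ⟨a, ha, h⟩
    rwa [(blaschkeFactor_eq_zero_iff (hs a ha) hz).mp h]
  · exact fun h => ⟨z, h, (blaschkeFactor_eq_zero_iff hz hz).mpr rfl⟩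

theorem differentiableOn_blaschkeProd {s : Multiset ℂ} (hs : ∀ a ∈ s, a ∈ ball (0 : ℂ) 1) :
    DifferentiableOn ℂ (blaschkeProd s) (ball 0 1) := by
  induction s using Multiset.induction_on with
  | empty => exact (differentiableOn_const 1).congr fun z _ => by simp
  | cons a s ih =>
    exact ((differentiableOn_blaschkeFactor (hs a (by simp))).mul
      (ih fun b hb => hs b (by simp [hb]))).congr fun z _ => by simp

/-- Multisets of zeros replace indexed families, since the squeezing argument passes to
sub-multisets and inducts on the zeros. -/
theorem isFiniteBlaschke_iff {n : ℕ} {f : ℂ → ℂ} :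
    IsFiniteBlaschke n f ↔ 0 < n ∧ ∃ c s, Multiset.card s = n ∧ IsBlaschkeWith c s f := by
  constructor
  · rintro ⟨hn, c, a, hc, ha, hf⟩
    refine ⟨hn, c, Finset.univ.val.map a, by simp, hc, ?_, ?_⟩
    · simpa using ha
    · intro z hz
      rw [hf z hz, blaschkeProd, Multiset.map_map]
      rfl
  · rintro ⟨hn, c, s, hs, hf⟩
    obtain ⟨l, rfl⟩ : ∃ l : List ℂ, (l : Multiset ℂ) = s := Quot.exists_rep s
    have hl : l.length = n := hs
    subst hl
    refine ⟨hn, c, l.get, hf.norm_const, fun j => hf.zeros_mem _ (List.get_mem l j), ?_⟩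
    intro z hz
    have h : blaschkeProd l z = (l.map fun a => blaschkeFactor a z).prod := by simp [blaschkeProd]
    rw [hf.eq_on z hz, h, ← List.prod_ofFn]
    congr 2
    conv_lhs => rw [← List.ofFn_get l, List.map_ofFn]
    rfl

namespace IsBlaschkeWith

variable {c : ℂ} {s : Multiset ℂ} {f : ℂ → ℂ}

theorem differentiableOn (hf : IsBlaschkeWith c s f) : DifferentiableOn ℂ f (ball 0 1) :=
  ((differentiableOn_blaschkeProd hf.zeros_mem).const_mul c).congr hf.eq_on

theorem norm_eq (hf : IsBlaschkeWith c s f) {z : ℂ} (hz : z ∈ ball (0 : ℂ) 1) :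
    ‖f z‖ = ‖blaschkeProd s z‖ := by
  rw [hf.eq_on z hz, norm_mul, hf.norm_const, one_mul]

theorem norm_le_one (hf : IsBlaschkeWith c s f) {z : ℂ} (hz : z ∈ ball (0 : ℂ) 1) :
    ‖f z‖ ≤ 1 := hf.norm_eq hz ▸ norm_blaschkeProd_le_one hf.zeros_mem hz

theorem mem_ball (hf : IsBlaschkeWith c s f) (h0 : s ≠ 0) {z : ℂ} (hz : z ∈ ball (0 : ℂ) 1) :
    f z ∈ ball (0 : ℂ) 1 :=
  mem_ball_zero_iff.mpr (hf.norm_eq hz ▸ norm_blaschkeProd_lt_one hf.zeros_mem h0 hz)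

theorem eq_zero_iff (hf : IsBlaschkeWith c s f) {z : ℂ} (hz : z ∈ ball (0 : ℂ) 1) :
    f z = 0 ↔ z ∈ s := by
  rw [← norm_eq_zero, hf.norm_eq hz, norm_eq_zero, blaschkeProd_eq_zero_iff hf.zeros_mem hz]

end IsBlaschkeWith

/-! ### Fibres as root sets of polynomials -/

/-- The numerator `∏ (X - a)` of a Blaschke product. -/
def blaschkeNum (s : Multiset ℂ) : ℂ[X] := (s.map fun a => X - C a).prod

/-- The denominator `∏ (1 - conj a X)` of a Blaschke product. -/
def blaschkeDen (s : Multiset ℂ) : ℂ[X] := (s.map fun a => 1 - C (conj a) * X).prod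

theorem eval_blaschkeNum (s : Multiset ℂ) (z : ℂ) :
    (blaschkeNum s).eval z = (s.map fun a => z - a).prod := by
  simp [blaschkeNum, eval_multiset_prod]

theorem eval_blaschkeDen (s : Multiset ℂ) (z : ℂ) :
    (blaschkeDen s).eval z = (s.map fun a => 1 - conj a * z).prod := by
  simp [blaschkeDen, eval_multiset_prod]

theorem eval_blaschkeDen_ne_zero {s : Multiset ℂ} (hs : ∀ a ∈ s, a ∈ ball (0 : ℂ) 1) {z : ℂ}
    (hz : ‖z‖ ≤ 1) : (blaschkeDen s).eval z ≠ 0 := by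
  rw [eval_blaschkeDen, Ne, Multiset.prod_eq_zero_iff, Multiset.mem_map]
  rintro ⟨a, ha, h⟩
  exact one_sub_conj_mul_ne_zero (hs a ha) hz h

theorem blaschkeProd_eq_div (s : Multiset ℂ) (z : ℂ) :
    blaschkeProd s z = (blaschkeNum s).eval z / (blaschkeDen s).eval z := by
  rw [eval_blaschkeNum, eval_blaschkeDen, blaschkeProd]
  exact Multiset.prod_map_div

theorem norm_eval_blaschkeDen_le {s : Multiset ℂ} (hs : ∀ a ∈ s, a ∈ ball (0 : ℂ) 1) {z : ℂ}
    (hz : 1 ≤ ‖z‖) : ‖(blaschkeDen s).eval z‖ ≤ ‖(blaschkeNum s).eval z‖ := by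
  rw [eval_blaschkeNum, eval_blaschkeDen]
  induction s using Multiset.induction_on with
  | empty => simp
  | cons a s ih =>
    simp only [Multiset.map_cons, Multiset.prod_cons, norm_mul]
    refine mul_le_mul ?_ (ih fun b hb => hs b (by simp [hb])) (norm_nonneg _) (norm_nonneg _)
    have ha := mem_ball_zero_iff.mp (hs a (by simp))
    have h := normSq_blaschke_identity a z
    have h1 : 0 ≤ (1 - ‖a‖ ^ 2) * (‖z‖ ^ 2 - 1) := by
      apply mul_nonneg <;> nlinarith [norm_nonneg a, norm_nonneg z]
    exact le_of_sq_le_sq (by linarith) (norm_nonneg _)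

theorem natDegree_blaschkeDen_le (s : Multiset ℂ) :
    (blaschkeDen s).natDegree ≤ Multiset.card s := by
  induction s using Multiset.induction_on with
  | empty => simp [blaschkeDen]
  | cons a s ih =>
    have : blaschkeDen (a ::ₘ s) = (1 - C (conj a) * X) * blaschkeDen s := by simp [blaschkeDen]
    rw [this, Multiset.card_cons, add_comm]
    refine natDegree_mul_le.trans (add_le_add ?_ ih)
    compute_degree

/-- This coefficient is the product of the numbers `-conj a`. The bound keeps the degree of
`fiberPoly` from dropping when `‖w‖ < 1`. -/
theorem norm_coeff_blaschkeDen_le {s : Multiset ℂ} (hs : ∀ a ∈ s, a ∈ ball (0 : ℂ) 1) :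
    ‖(blaschkeDen s).coeff (Multiset.card s)‖ ≤ 1 := by
  induction s using Multiset.induction_on with
  | empty => simp [blaschkeDen]
  | cons a s ih =>
    have : blaschkeDen (a ::ₘ s) = (1 - C (conj a) * X) * blaschkeDen s := by simp [blaschkeDen]
    rw [this, Multiset.card_cons, add_comm,
      coeff_mul_add_eq_of_natDegree_le (by compute_degree) (natDegree_blaschkeDen_le s), norm_mul]
    refine mul_le_one₀ ?_ (norm_nonneg _) (ih fun b hb => hs b (by simp [hb]))
    have := (mem_ball_zero_iff.mp (hs a (by simp))).le
    simpa [coeff_one] using this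

theorem coeff_blaschkeDen_of_zero_mem {s : Multiset ℂ} (h0 : (0 : ℂ) ∈ s) :
    (blaschkeDen s).coeff (Multiset.card s) = 0 := by
  obtain ⟨t, rfl⟩ := Multiset.exists_cons_of_mem h0
  have : blaschkeDen (0 ::ₘ t) = blaschkeDen t := by simp [blaschkeDen]
  rw [this, Multiset.card_cons]
  exact coeff_eq_zero_of_natDegree_lt (Nat.lt_succ_of_le (natDegree_blaschkeDen_le t))

theorem monic_blaschkeNum (s : Multiset ℂ) : (blaschkeNum s).Monic :=
  monic_multiset_prod_of_monic _ _ fun a _ => monic_X_sub_C a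

theorem natDegree_blaschkeNum (s : Multiset ℂ) : (blaschkeNum s).natDegree = Multiset.card s :=
  natDegree_multiset_prod_X_sub_C_eq_card s

/-- The polynomial whose roots are the solutions of `f z = w` in the disk. -/
def fiberPoly (c : ℂ) (s : Multiset ℂ) (w : ℂ) : ℂ[X] :=
  C c * blaschkeNum s - C w * blaschkeDen s

section Fiber

variable {c : ℂ} {s : Multiset ℂ} {f : ℂ → ℂ} {w : ℂ}

theorem natDegree_fiberPoly_le : (fiberPoly c s w).natDegree ≤ Multiset.card s := by
  refine (natDegree_sub_le _ _).trans (max_le ?_ ?_)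
  · exact (natDegree_C_mul_le _ _).trans (natDegree_blaschkeNum s).le
  · exact (natDegree_C_mul_le _ _).trans (natDegree_blaschkeDen_le s)

theorem coeff_fiberPoly : (fiberPoly c s w).coeff (Multiset.card s) =
    c - w * (blaschkeDen s).coeff (Multiset.card s) := by
  have h := (monic_blaschkeNum s).coeff_natDegree
  rw [natDegree_blaschkeNum] at h
  simp [fiberPoly, h]

theorem IsBlaschkeWith.coeff_fiberPoly_ne_zero (hf : IsBlaschkeWith c s f)
    (hw : w ∈ ball (0 : ℂ) 1) : (fiberPoly c s w).coeff (Multiset.card s) ≠ 0 := by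
  rw [coeff_fiberPoly]
  intro h
  have h1 := congrArg norm (sub_eq_zero.mp h)
  rw [hf.norm_const, norm_mul] at h1
  have h2 := norm_coeff_blaschkeDen_le hf.zeros_mem
  rw [mem_ball_zero_iff] at hw
  nlinarith [norm_nonneg w, norm_nonneg ((blaschkeDen s).coeff (Multiset.card s))]

theorem IsBlaschkeWith.natDegree_fiberPoly (hf : IsBlaschkeWith c s f)
    (hw : w ∈ ball (0 : ℂ) 1) : (fiberPoly c s w).natDegree = Multiset.card s :=
  natDegree_eq_of_le_of_coeff_ne_zero natDegree_fiberPoly_le (hf.coeff_fiberPoly_ne_zero hw)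

theorem IsBlaschkeWith.fiberPoly_ne_zero (hf : IsBlaschkeWith c s f)
    (hw : w ∈ ball (0 : ℂ) 1) : fiberPoly c s w ≠ 0 := by
  intro h
  apply hf.coeff_fiberPoly_ne_zero hw
  rw [h, coeff_zero]

theorem IsBlaschkeWith.eval_fiberPoly (hf : IsBlaschkeWith c s f) {z : ℂ}
    (hz : z ∈ ball (0 : ℂ) 1) :
    (fiberPoly c s w).eval z = (f z - w) * (blaschkeDen s).eval z := by
  have h := eval_blaschkeDen_ne_zero hf.zeros_mem (mem_ball_zero_iff.mp hz).le
  rw [hf.eq_on z hz, blaschkeProd_eq_div, fiberPoly]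
  simp
  field_simp

theorem IsBlaschkeWith.card_roots_fiberPoly (hf : IsBlaschkeWith c s f)
    (hw : w ∈ ball (0 : ℂ) 1) : Multiset.card (fiberPoly c s w).roots = Multiset.card s := by
  rw [← hf.natDegree_fiberPoly hw]
  exact (splits_iff_card_roots.mp (IsAlgClosed.splits _))

/-- No root lies outside the disk: there the numerator dominates the denominator, so a root would
force `‖w‖ ≥ 1`. -/
theorem IsBlaschkeWith.mem_roots_fiberPoly (hf : IsBlaschkeWith c s f)
    (hw : w ∈ ball (0 : ℂ) 1) {z : ℂ} :
    z ∈ (fiberPoly c s w).roots ↔ z ∈ ball (0 : ℂ) 1 ∧ f z = w := by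
  rw [mem_roots (hf.fiberPoly_ne_zero hw), IsRoot.def]
  constructor
  · intro h
    have hz : z ∈ ball (0 : ℂ) 1 := by
      by_contra hz
      have hz1 : 1 ≤ ‖z‖ := by simpa using hz
      have h1 := norm_eval_blaschkeDen_le hf.zeros_mem hz1
      have h2 : (blaschkeNum s).eval z ≠ 0 := by
        rw [eval_blaschkeNum]
        intro h3
        obtain ⟨a, ha, h4⟩ := Multiset.mem_map.mp (Multiset.prod_eq_zero_iff.mp h3)
        rw [sub_eq_zero] at h4
        exact hz (h4 ▸ hf.zeros_mem a ha)
      have h3 : c * (blaschkeNum s).eval z = w * (blaschkeDen s).eval z := by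
        simpa [fiberPoly, sub_eq_zero] using h
      have h4 := congrArg norm h3
      rw [norm_mul, norm_mul, hf.norm_const] at h4
      have h5 := norm_pos_iff.mpr h2
      rw [mem_ball_zero_iff] at hw
      nlinarith [norm_nonneg w]
    refine ⟨hz, ?_⟩
    rw [hf.eval_fiberPoly hz] at h
    simpa [eval_blaschkeDen_ne_zero hf.zeros_mem (mem_ball_zero_iff.mp hz).le, sub_eq_zero]
      using h
  · rintro ⟨hz, h⟩
    rw [hf.eval_fiberPoly hz, h, sub_self, zero_mul]

theorem IsBlaschkeWith.nodup_roots_fiberPoly (hf : IsBlaschkeWith c s f)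
    (hw : w ∈ ball (0 : ℂ) 1) (hd : ∀ z ∈ ball (0 : ℂ) 1, f z = w → deriv f z ≠ 0) :
    (fiberPoly c s w).roots.Nodup := by
  rw [Multiset.nodup_iff_count_le_one]
  intro z
  by_contra! h
  rw [count_roots] at h
  have hmem : z ∈ (fiberPoly c s w).roots := by
    rw [← Multiset.count_pos, count_roots]; omega
  obtain ⟨hz, hfz⟩ := (hf.mem_roots_fiberPoly hw).mp hmem
  have h2 := ((one_lt_rootMultiplicity_iff_isRoot (hf.fiberPoly_ne_zero hw)).mp h).2
  have hfd : HasDerivAt f (deriv f z) z :=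
    (hf.differentiableOn.differentiableAt (isOpen_ball.mem_nhds hz)).hasDerivAt
  -- In the product rule the term containing `f z - w` vanishes, which leaves `deriv f z` times a
  -- nonzero number; a multiple root would make this 0.
  have h3 := (hfd.sub_const w).mul ((blaschkeDen s).hasDerivAt z)
  have h4 := ((fiberPoly c s w).hasDerivAt z).congr_of_eventuallyEq
    (f₁ := fun x => (f x - w) * (blaschkeDen s).eval x)
    (by filter_upwards [isOpen_ball.mem_nhds hz] with x hx using (hf.eval_fiberPoly hx).symm)
  have h5 := h3.unique h4
  rw [IsRoot.def] at h2
  rw [h2, hfz] at h5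
  simp [eval_blaschkeDen_ne_zero hf.zeros_mem (mem_ball_zero_iff.mp hz).le, hd z hz hfz] at h5

/-- Vieta: because 0 is a zero of `f`, the denominator has degree below `card s`, so the leading
coefficient is `c` for every `w`, while the constant coefficient is `-w`. -/
theorem IsBlaschkeWith.norm_prod_roots_fiberPoly (hf : IsBlaschkeWith c s f)
    (hw : w ∈ ball (0 : ℂ) 1) (h0 : f 0 = 0) : ‖(fiberPoly c s w).roots.prod‖ = ‖w‖ := by
  have hs : (0 : ℂ) ∈ s := (hf.eq_zero_iff (by simp)).mp h0
  have h1 := (IsAlgClosed.splits (fiberPoly c s w)).coeff_zero_eq_leadingCoeff_mul_prod_roots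
  have h2 : (fiberPoly c s w).leadingCoeff = c := by
    rw [leadingCoeff, hf.natDegree_fiberPoly hw, coeff_fiberPoly, coeff_blaschkeDen_of_zero_mem hs]
    simp
  have h3 : (fiberPoly c s w).coeff 0 = -w := by
    rw [coeff_zero_eq_eval_zero, hf.eval_fiberPoly (by simp), h0, eval_blaschkeDen]
    simp
  rw [h2, h3] at h1
  have h4 := congrArg norm h1
  simpa [hf.norm_const] using h4.symm

theorem IsBlaschkeWith.exists_preimage (hf : IsBlaschkeWith c s f) (hs : s ≠ 0)
    (hw : w ∈ ball (0 : ℂ) 1) : ∃ z ∈ ball (0 : ℂ) 1, f z = w := by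
  have h : (fiberPoly c s w).roots ≠ 0 := by
    rw [← Multiset.card_pos, hf.card_roots_fiberPoly hw]
    exact Multiset.card_pos.mpr hs
  obtain ⟨z, hz⟩ := Multiset.exists_mem_of_ne_zero h
  exact ⟨z, (hf.mem_roots_fiberPoly hw).mp hz⟩

theorem IsBlaschkeWith.finite_fiber (hf : IsBlaschkeWith c s f) (hw : w ∈ ball (0 : ℂ) 1) :
    {z | z ∈ ball (0 : ℂ) 1 ∧ f z = w}.Finite := by
  refine ((fiberPoly c s w).roots.toFinset.finite_toSet).subset fun z hz => ?_
  simpa using (hf.mem_roots_fiberPoly hw).mpr hz |> fun h => Multiset.mem_toFinset.mpr h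

theorem IsBlaschkeWith.coe_toFinset_roots (hf : IsBlaschkeWith c s f)
    (hw : w ∈ ball (0 : ℂ) 1) :
    ((fiberPoly c s w).roots.toFinset : Set ℂ) = {z | z ∈ ball (0 : ℂ) 1 ∧ f z = w} := by
  ext z
  rw [Finset.mem_coe, Multiset.mem_toFinset, hf.mem_roots_fiberPoly hw]
  rfl

theorem IsBlaschkeWith.ncard_fiber_le (hf : IsBlaschkeWith c s f) (hw : w ∈ ball (0 : ℂ) 1) :
    {z | z ∈ ball (0 : ℂ) 1 ∧ f z = w}.ncard ≤ Multiset.card s := by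
  rw [← hf.coe_toFinset_roots hw, Set.ncard_coe_finset, ← hf.card_roots_fiberPoly hw]
  exact Multiset.toFinset_card_le _

theorem IsBlaschkeWith.ncard_fiber (hf : IsBlaschkeWith c s f) (hw : w ∈ ball (0 : ℂ) 1)
    (hd : ∀ z ∈ ball (0 : ℂ) 1, f z = w → deriv f z ≠ 0) :
    {z | z ∈ ball (0 : ℂ) 1 ∧ f z = w}.ncard = Multiset.card s := by
  rw [← hf.coe_toFinset_roots hw, Set.ncard_coe_finset, ← hf.card_roots_fiberPoly hw]
  exact Multiset.toFinset_card_of_nodup (hf.nodup_roots_fiberPoly hw hd)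

theorem IsBlaschkeWith.finite_critical_points (hf : IsBlaschkeWith c s f) (hs : s ≠ 0) :
    {z | z ∈ ball (0 : ℂ) 1 ∧ deriv f z = 0}.Finite := by
  set q := blaschkeDen s with hq
  set p := C c * blaschkeNum s with hp
  -- The numerator of the derivative of `p / q`; critical points are among its roots.
  set N : ℂ[X] := derivative p * q - p * derivative q with hN
  have key : ∀ z ∈ ball (0 : ℂ) 1, N.eval z = deriv f z * q.eval z ^ 2 := by
    intro z hz
    have hfd : HasDerivAt f (deriv f z) z :=
      (hf.differentiableOn.differentiableAt (isOpen_ball.mem_nhds hz)).hasDerivAt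
    have hpq : ∀ x ∈ ball (0 : ℂ) 1, f x * q.eval x = p.eval x := by
      intro x hx
      have := hf.eval_fiberPoly (w := 0) hx
      simpa [fiberPoly, hq, hp] using this.symm
    have h3 := hfd.mul (q.hasDerivAt z)
    have h4 := (p.hasDerivAt z).congr_of_eventuallyEq (f₁ := fun x => f x * q.eval x)
      (by filter_upwards [isOpen_ball.mem_nhds hz] with x hx using hpq x hx)
    have h5 := h3.unique h4
    rw [hN]
    simp only [eval_sub, eval_mul]
    rw [← h5, ← hpq z hz]
    ring
  have hN0 : N ≠ 0 := by
    intro h0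
    have hd : ∀ z ∈ ball (0 : ℂ) 1, deriv f z = 0 := by
      intro z hz
      have h := key z hz
      rw [h0, eval_zero] at h
      have hqz : q.eval z ≠ 0 :=
        eval_blaschkeDen_ne_zero hf.zeros_mem (mem_ball_zero_iff.mp hz).le
      simpa [hqz] using h.symm
    -- A function with zero derivative is constant on the disk, but `f` takes both values 0 and 1/2
    -- there.
    obtain ⟨z₁, hz₁, h1⟩ := hf.exists_preimage hs (w := 0) (by simp)
    obtain ⟨z₂, hz₂, h2⟩ := hf.exists_preimage hs (w := 1 / 2)
      (by rw [mem_ball_zero_iff]; norm_num)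
    have := isOpen_ball.is_const_of_deriv_eq_zero (convex_ball (0 : ℂ) 1).isPreconnected
      hf.differentiableOn hd hz₁ hz₂
    rw [h1, h2] at this
    norm_num at this
  refine (N.roots.toFinset.finite_toSet).subset fun z hz => ?_
  rw [Finset.mem_coe, Multiset.mem_toFinset, mem_roots hN0, IsRoot.def, key z hz.1, hz.2,
    zero_mul]

end Fiber
end

/-! ### Schwarz-Pick and the squeezing lemma -/

noncomputable section

open scoped ComplexConjugate

theorem le_of_eventually_le_punctured {u v : ℂ → ℝ} {a : ℂ} (hu : ContinuousAt u a)
    (hv : ContinuousAt v a) (h : ∀ᶠ z in 𝓝[≠] a, u z ≤ v z) : u a ≤ v a :=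
  le_of_tendsto_of_tendsto (hu.tendsto.mono_left nhdsWithin_le_nhds)
    (hv.tendsto.mono_left nhdsWithin_le_nhds) h

theorem le_on_ball_of_le_off_point {u v : ℂ → ℝ} {a : ℂ} (hu : ContinuousOn u (ball 0 1))
    (hv : ContinuousOn v (ball 0 1)) (h : ∀ z ∈ ball (0 : ℂ) 1, z ≠ a → u z ≤ v z) {z : ℂ}
    (hz : z ∈ ball (0 : ℂ) 1) : u z ≤ v z := by
  by_cases hza : z = a
  · subst hza
    refine le_of_eventually_le_punctured (hu.continuousAt (isOpen_ball.mem_nhds hz))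
      (hv.continuousAt (isOpen_ball.mem_nhds hz)) ?_
    filter_upwards [self_mem_nhdsWithin, mem_nhdsWithin_of_mem_nhds (isOpen_ball.mem_nhds hz)]
      with x hx hx1 using h x hx1 hx
  · exact h z hz hza

/-- The Schwarz–Pick lemma at a zero of `f`. -/
theorem norm_le_norm_blaschkeFactor {f : ℂ → ℂ} (hf : DifferentiableOn ℂ f (ball 0 1))
    (h1 : ∀ z ∈ ball (0 : ℂ) 1, ‖f z‖ ≤ 1) {a : ℂ} (ha : a ∈ ball (0 : ℂ) 1) (h0 : f a = 0)
    {z : ℂ} (hz : z ∈ ball (0 : ℂ) 1) : ‖f z‖ ≤ ‖blaschkeFactor a z‖ := by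
  have hna := neg_mem_unit_ball ha
  -- Precomposing with the automorphism that sends 0 to `a` moves the zero to the origin, where the
  -- Schwarz lemma applies.
  have h := Complex.norm_le_norm_of_mapsTo_ball (f := fun ζ => f (blaschkeFactor (-a) ζ)) (R := 1)
    (z := blaschkeFactor a z)
    (hf.comp (differentiableOn_blaschkeFactor hna) fun ζ hζ => blaschkeFactor_mem_ball hna hζ)
    (fun ζ hζ => by simpa using h1 _ (blaschkeFactor_mem_ball hna hζ))
    (by simpa [blaschkeFactor] using h0) (norm_blaschkeFactor_lt_one ha hz)
  simpa only [blaschkeFactor_neg_comp ha hz] using h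

theorem exists_eq_blaschkeFactor_mul {f : ℂ → ℂ} (hf : DifferentiableOn ℂ f (ball 0 1))
    (h1 : ∀ z ∈ ball (0 : ℂ) 1, ‖f z‖ ≤ 1) {a : ℂ} (ha : a ∈ ball (0 : ℂ) 1) (h0 : f a = 0) :
    ∃ g : ℂ → ℂ, DifferentiableOn ℂ g (ball 0 1) ∧ (∀ z ∈ ball (0 : ℂ) 1, ‖g z‖ ≤ 1) ∧
      ∀ z ∈ ball (0 : ℂ) 1, f z = blaschkeFactor a z * g z := by
  have hd : DifferentiableOn ℂ (fun z => dslope f a z * (1 - conj a * z)) (ball 0 1) :=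
    (((Complex.differentiableOn_dslope (isOpen_ball.mem_nhds ha)).mpr hf).mul
      (by fun_prop : DifferentiableOn ℂ (fun z => 1 - conj a * z) (ball 0 1)))
  have heq : ∀ z ∈ ball (0 : ℂ) 1,
      f z = blaschkeFactor a z * (dslope f a z * (1 - conj a * z)) := by
    intro z hz
    have hne := one_sub_conj_mul_ne_zero ha (mem_ball_zero_iff.mp hz).le
    have h := sub_smul_dslope f a z
    rw [h0, sub_zero, smul_eq_mul] at h
    rw [← h, blaschkeFactor, div_mul_eq_mul_div, eq_div_iff hne]
    ring
  refine ⟨_, hd, fun z hz => ?_, heq⟩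
  refine le_on_ball_of_le_off_point (a := a) hd.continuousOn.norm
    (continuousOn_const (c := (1 : ℝ))) (fun x hx hxa => ?_) hz
  have h := norm_le_norm_blaschkeFactor hf h1 ha h0 hx
  have hpos : 0 < ‖blaschkeFactor a x‖ :=
    norm_pos_iff.mpr fun h' => hxa ((blaschkeFactor_eq_zero_iff ha hx).mp h')
  rw [heq x hx, norm_mul] at h
  exact le_of_mul_le_mul_left (by rwa [mul_one]) hpos

/-- A minimum principle without boundary values: the quotient of the product by `f` is bounded by 1
and vanishes at `a`, so Schwarz-Pick allows the factor at `a` to be cancelled from the bound.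
Repeating this leaves the empty product. -/
theorem one_le_norm_of_blaschkeProd_le {s : Multiset ℂ} (hs : ∀ a ∈ s, a ∈ ball (0 : ℂ) 1)
    {f : ℂ → ℂ} (hf : DifferentiableOn ℂ f (ball 0 1)) (hne : ∀ z ∈ ball (0 : ℂ) 1, f z ≠ 0)
    (h : ∀ z ∈ ball (0 : ℂ) 1, ‖blaschkeProd s z‖ ≤ ‖f z‖) :
    ∀ z ∈ ball (0 : ℂ) 1, 1 ≤ ‖f z‖ := by
  induction s using Multiset.induction_on with
  | empty => simpa using h
  | cons a s ih =>
    have hs' : ∀ b ∈ s, b ∈ ball (0 : ℂ) 1 := fun b hb => hs b (by simp [hb])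
    have ha := hs a (by simp)
    refine ih hs' fun z hz => ?_
    refine le_on_ball_of_le_off_point (a := a)
      (differentiableOn_blaschkeProd hs').continuousOn.norm hf.continuousOn.norm
      (fun x hx hxa => ?_) hz
    have h2 := norm_le_norm_blaschkeFactor (f := fun z => blaschkeProd (a ::ₘ s) z / f z)
      ((differentiableOn_blaschkeProd hs).div hf hne)
      (fun z hz => by
        rw [norm_div]; exact div_le_one_of_le₀ (h z hz) (norm_nonneg _)) ha
      (by simp [(blaschkeFactor_eq_zero_iff ha ha).mpr rfl]) hx
    have hpos : 0 < ‖blaschkeFactor a x‖ :=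
      norm_pos_iff.mpr fun h' => hxa ((blaschkeFactor_eq_zero_iff ha hx).mp h')
    rw [norm_div, div_le_iff₀ (norm_pos_iff.mpr (hne x hx)), blaschkeProd_cons, norm_mul] at h2
    exact le_of_mul_le_mul_left h2 hpos

/-- A holomorphic function squeezed between a finite Blaschke product and `1` is a finite Blaschke
product, whose zeros are among those of the given one. -/
theorem exists_isBlaschkeWith_of_blaschkeProd_le {s : Multiset ℂ}
    (hs : ∀ a ∈ s, a ∈ ball (0 : ℂ) 1) {f : ℂ → ℂ} (hf : DifferentiableOn ℂ f (ball 0 1))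
    (h1 : ∀ z ∈ ball (0 : ℂ) 1, ‖f z‖ ≤ 1)
    (h : ∀ z ∈ ball (0 : ℂ) 1, ‖blaschkeProd s z‖ ≤ ‖f z‖) :
    ∃ c t, t ≤ s ∧ IsBlaschkeWith c t f := by
  induction hn : Multiset.card s generalizing s f with
  | zero =>
    obtain rfl : s = 0 := Multiset.card_eq_zero.mp hn
    have hone : ∀ z ∈ ball (0 : ℂ) 1, ‖f z‖ = 1 := fun z hz =>
      le_antisymm (h1 z hz) (by simpa using h z hz)
    -- With no zeros left the modulus is identically 1, and the maximum principle makes `f`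
    -- constant.
    have hconst := Complex.eqOn_of_isPreconnected_of_isMaxOn_norm
      (convex_ball (0 : ℂ) 1).isPreconnected isOpen_ball hf (c := 0) (by simp)
      (fun z hz => by
        change ‖f z‖ ≤ ‖f 0‖
        rw [hone z hz, hone 0 (by simp)])
    exact ⟨f 0, 0, le_rfl, hone 0 (by simp), by simp, fun z hz => by simpa using hconst hz⟩
  | succ n ih =>
    by_cases hz : ∃ a ∈ ball (0 : ℂ) 1, f a = 0
    · obtain ⟨a, ha, h0⟩ := hz
      have has : a ∈ s := by
        rw [← blaschkeProd_eq_zero_iff hs ha, ← norm_le_zero_iff]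
        simpa [h0] using h a ha
      obtain ⟨s, rfl⟩ := Multiset.exists_cons_of_mem has
      have hs' : ∀ b ∈ s, b ∈ ball (0 : ℂ) 1 := fun b hb => hs b (by simp [hb])
      obtain ⟨g, hg, hg1, hfg⟩ := exists_eq_blaschkeFactor_mul hf h1 ha h0
      obtain ⟨c, t, hts, ht⟩ := ih hs' hg hg1 (fun z hz => by
        refine le_on_ball_of_le_off_point (a := a)
          (differentiableOn_blaschkeProd hs').continuousOn.norm hg.continuousOn.norm
          (fun x hx hxa => ?_) hz
        have h2 := h x hx
        have hpos : 0 < ‖blaschkeFactor a x‖ :=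
          norm_pos_iff.mpr fun h' => hxa ((blaschkeFactor_eq_zero_iff ha hx).mp h')
        rw [hfg x hx, blaschkeProd_cons, norm_mul, norm_mul] at h2
        exact le_of_mul_le_mul_left h2 hpos) (by simpa using hn)
      refine ⟨c, a ::ₘ t, (Multiset.cons_le_cons_iff a).mpr hts, ht.norm_const, ?_, ?_⟩
      · intro b hb
        exact hs b (Multiset.mem_of_le ((Multiset.cons_le_cons_iff a).mpr hts) hb)
      · intro z hz
        rw [hfg z hz, ht.eq_on z hz, blaschkeProd_cons]
        ring
    · push Not at hz
      obtain ⟨a, ha⟩ := Multiset.card_pos_iff_exists_mem.mp (by omega : 0 < Multiset.card s)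
      -- If `f` has no zeros, then `‖f‖ ≥ 1` already, so the lower bound survives dropping an
      -- arbitrary factor and the induction goes on.
      have hone := one_le_norm_of_blaschkeProd_le hs hf hz h
      obtain ⟨t, rfl⟩ := Multiset.exists_cons_of_mem ha
      obtain ⟨c, t', ht', hc⟩ := ih (s := t) (fun b hb => hs b (by simp [hb])) hf h1
        (fun z hz => (norm_blaschkeProd_le_one (fun b hb => hs b (by simp [hb])) hz).trans
          (hone z hz)) (by simpa using hn)
      exact ⟨c, t', ht'.trans (Multiset.le_cons_self t a), hc⟩
end

/-! ### Factoring through a finite Blaschke product -/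

noncomputable section

theorem exists_local_inverse {f : ℂ → ℂ} {z : ℂ} (hf : AnalyticAt ℂ f z) (h : deriv f z ≠ 0) :
    ∃ g : ℂ → ℂ, AnalyticAt ℂ g (f z) ∧ g (f z) = z ∧ (∀ᶠ y in 𝓝 (f z), f (g y) = y) ∧
      ∀ᶠ x in 𝓝 z, g (f x) = x := by
  have hs : HasStrictDerivAt f (deriv f z) z := hf.hasStrictDerivAt
  refine ⟨hs.localInverse f _ z h, hf.analyticAt_localInverse h,
    (hs.eventually_left_inverse h).self_of_nhds, hs.eventually_right_inverse h,
    hs.eventually_left_inverse h⟩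

namespace IsBlaschkeWith

variable {c d : ℂ} {s t : Multiset ℂ} {f b : ℂ → ℂ}

theorem analyticAt (hf : IsBlaschkeWith c s f) {z : ℂ} (hz : z ∈ ball (0 : ℂ) 1) :
    AnalyticAt ℂ f z := hf.differentiableOn.analyticAt (isOpen_ball.mem_nhds hz)

theorem nhds_le_map (hf : IsBlaschkeWith c s f) (hs : s ≠ 0) {z : ℂ}
    (hz : z ∈ ball (0 : ℂ) 1) : 𝓝 (f z) ≤ map f (𝓝 z) := by
  refine (hf.analyticAt hz).eventually_constant_or_nhds_le_map_nhds.resolve_left fun h => ?_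
  refine infinite_of_mem_nhds z ?_ (hf.finite_fiber (hf.mem_ball hs hz))
  filter_upwards [h, isOpen_ball.mem_nhds hz] with x hx hxd using ⟨hxd, hx⟩

/-- If the values differed, they would have disjoint neighbourhoods. As `b` is open, every point
near `z` has a partner near `z'` with the same value of `b`, and infinitely many points near `z`
avoid the finite set `S`. -/
theorem eq_of_eq_of_generic (hb : IsBlaschkeWith d t b) (ht : t ≠ 0)
    (hf : ContinuousOn f (ball 0 1)) {S : Set ℂ} (hS : S.Finite)
    (h : ∀ z ∈ ball (0 : ℂ) 1, z ∉ S → ∀ z' ∈ ball (0 : ℂ) 1, b z = b z' → f z = f z')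
    {z z' : ℂ} (hz : z ∈ ball (0 : ℂ) 1) (hz' : z' ∈ ball (0 : ℂ) 1) (hbz : b z = b z') :
    f z = f z' := by
  by_contra hne
  obtain ⟨V, V', hV, hV', hzV, hzV', hd⟩ := t2_separation hne
  have h1 : f ⁻¹' V ∈ 𝓝 z :=
    (hf.continuousAt (isOpen_ball.mem_nhds hz)).preimage_mem_nhds (hV.mem_nhds hzV)
  have h2 : f ⁻¹' V' ∩ ball 0 1 ∈ 𝓝 z' := inter_mem
    ((hf.continuousAt (isOpen_ball.mem_nhds hz')).preimage_mem_nhds (hV'.mem_nhds hzV'))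
    (isOpen_ball.mem_nhds hz')
  have h3 : b ⁻¹' (b '' (f ⁻¹' V' ∩ ball 0 1)) ∈ 𝓝 z := by
    refine (hb.analyticAt hz).continuousAt.preimage_mem_nhds ?_
    rw [hbz]
    exact hb.nhds_le_map ht hz' (image_mem_map h2)
  have h4 := infinite_of_mem_nhds z (inter_mem (inter_mem h1 h3) (isOpen_ball.mem_nhds hz))
  obtain ⟨x, ⟨⟨hxV, ⟨x', ⟨hxV', hx'⟩, hbx⟩⟩, hx⟩, hxS⟩ := (h4.sdiff hS).nonempty
  exact hd.le_bot ⟨hxV, by rw [h x hx hxS x' hx' hbx.symm]; exact hxV'⟩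

/-- A finite Blaschke product which is constant on the fibres of another one factors through it. -/
theorem exists_factor (hf : IsBlaschkeWith c s f) (hb : IsBlaschkeWith d t b) (ht : t ≠ 0)
    (h : ∀ z ∈ ball (0 : ℂ) 1, ∀ z' ∈ ball (0 : ℂ) 1, b z = b z' → f z = f z') :
    ∃ c' s' J, IsBlaschkeWith c' s' J ∧ ∀ z ∈ ball (0 : ℂ) 1, f z = J (b z) := by
  have hsurj : ∀ u ∈ ball (0 : ℂ) 1, ∃ z ∈ ball (0 : ℂ) 1, b z = u :=
    fun u hu => hb.exists_preimage ht hu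
  set J : ℂ → ℂ := fun u => f (Function.invFunOn b (ball 0 1) u) with hJ
  have hJb : ∀ z ∈ ball (0 : ℂ) 1, J (b z) = f z := by
    intro z hz
    have hex : ∃ x ∈ ball (0 : ℂ) 1, b x = b z := ⟨z, hz, rfl⟩
    exact h _ (Function.invFunOn_mem hex) z hz (Function.invFunOn_eq hex)
  have hcont : ∀ u ∈ ball (0 : ℂ) 1, ContinuousAt J u := by
    intro u hu
    obtain ⟨z, hz, rfl⟩ := hsurj u hu
    refine Tendsto.mono_left ?_ (hb.nhds_le_map ht hz)
    rw [tendsto_map'_iff, hJb z hz]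
    refine (hf.analyticAt hz).continuousAt.tendsto.congr' ?_
    filter_upwards [isOpen_ball.mem_nhds hz] with x hx using (hJb x hx).symm
  set S : Set ℂ := b '' {z | z ∈ ball (0 : ℂ) 1 ∧ deriv b z = 0} with hS
  have hSfin : S.Finite := (hb.finite_critical_points ht).image b
  have hdiff : ∀ u ∈ ball (0 : ℂ) 1, u ∉ S → DifferentiableAt ℂ J u := by
    intro u hu huS
    obtain ⟨z, hz, rfl⟩ := hsurj u hu
    have hdz : deriv b z ≠ 0 := fun h0 => huS ⟨z, ⟨hz, h0⟩, rfl⟩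
    obtain ⟨g, hg, hgz, hbg, -⟩ := exists_local_inverse (hb.analyticAt hz) hdz
    have hfg : DifferentiableAt ℂ (f ∘ g) (b z) := by
      refine DifferentiableAt.comp _ ?_ hg.differentiableAt
      rw [hgz]
      exact (hf.analyticAt hz).differentiableAt
    refine hfg.congr_of_eventuallyEq ?_
    have hmem : ∀ᶠ y in 𝓝 (b z), g y ∈ ball (0 : ℂ) 1 :=
      hg.continuousAt.eventually_mem (by rw [hgz]; exact isOpen_ball.mem_nhds hz)
    filter_upwards [hbg, hmem] with y hy hym
    rw [Function.comp_apply, ← hJb _ hym, hy]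
  -- Local inverses of `b` give differentiability only off its critical values; continuity at these
  -- finitely many points makes `J` holomorphic there too.
  have hJd : DifferentiableOn ℂ J (ball 0 1) := by
    intro u hu
    obtain ⟨r, hr, hrs⟩ := nhds_basis_closedBall.mem_iff.mp (isOpen_ball.mem_nhds hu)
    lift r to NNReal using hr.le
    have := Complex.hasFPowerSeriesOnBall_of_differentiable_off_countable (c := u) (R := r)
      (f := J) hSfin.countable (fun x hx => (hcont x (hrs hx)).continuousWithinAt)
      (fun x hx => hdiff x (hrs (ball_subset_closedBall hx.1)) hx.2) (by exact_mod_cast hr)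
    exact this.analyticAt.differentiableAt.differentiableWithinAt
  have hzeros : ∀ u ∈ s.map b, u ∈ ball (0 : ℂ) 1 := by
    intro u hu
    obtain ⟨a, ha, rfl⟩ := Multiset.mem_map.mp hu
    exact hb.mem_ball ht (hf.zeros_mem a ha)
  -- The lower bound for `J` is the Blaschke product with zeros `b a`, `a ∈ s`: by Schwarz-Pick,
  -- each of its factors at `b z` is at most the factor of `f` with zero `a` at `z`.
  obtain ⟨c', s', -, hJ'⟩ := exists_isBlaschkeWith_of_blaschkeProd_le hzeros hJd
    (fun u hu => by
      obtain ⟨z, hz, rfl⟩ := hsurj u hu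
      rw [hJb z hz]
      exact hf.norm_le_one hz)
    (fun u hu => by
      obtain ⟨z, hz, rfl⟩ := hsurj u hu
      rw [hJb z hz, hf.norm_eq hz]
      have hle : ∀ a ∈ s, ‖blaschkeFactor (b a) (b z)‖ ≤ ‖blaschkeFactor a z‖ := by
        intro a ha
        have ham := hf.zeros_mem a ha
        have hbam := hb.mem_ball ht ham
        refine norm_le_norm_blaschkeFactor (f := fun x => blaschkeFactor (b a) (b x))
          ((differentiableOn_blaschkeFactor hbam).comp hb.differentiableOn
            fun x hx => hb.mem_ball ht hx)
          (fun x hx => (norm_blaschkeFactor_lt_one hbam (hb.mem_ball ht hx)).le) ham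
          ((blaschkeFactor_eq_zero_iff hbam hbam).mpr rfl) hz
      have key : ∀ s' : Multiset ℂ, (∀ a ∈ s', a ∈ s) →
          ‖blaschkeProd (s'.map b) (b z)‖ ≤ ‖blaschkeProd s' z‖ := by
        intro s'
        induction s' using Multiset.induction_on with
        | empty => simp
        | cons a s' ih =>
          intro hs'
          rw [Multiset.map_cons, blaschkeProd_cons, blaschkeProd_cons, norm_mul, norm_mul]
          exact mul_le_mul (hle a (hs' a (by simp))) (ih fun b hb => hs' b (by simp [hb]))
            (norm_nonneg _) (norm_nonneg _)
      exact key s fun a ha => ha)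
  exact ⟨c', s', J, hJ', fun z hz => (hJb z hz).symm⟩

end IsBlaschkeWith
end

/-! ### The covering over the regular values -/

noncomputable section

/-- The points of the disk which are not critical values of `f`. -/
def regularValues (f : ℂ → ℂ) : Set ℂ := ball 0 1 \ diskCriticalValues f

/-- The points of the disk which `f` maps to regular values. -/
def regularPoints (f : ℂ → ℂ) : Set ℂ := {z | z ∈ ball (0 : ℂ) 1 ∧ f z ∈ regularValues f}

/-- The disk is homeomorphic to the plane, where complements of countable sets are connected. -/
theorem isPreconnected_unit_ball_diff {S : Set ℂ} (hS : S.Countable) :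
    IsPreconnected (ball (0 : ℂ) 1 \ S) := by
  set e : ℂ → ℂ := fun z => (Homeomorph.unitBall z : ℂ) with he
  have hinj : Function.Injective e :=
    Subtype.val_injective.comp (Homeomorph.unitBall (E := ℂ)).injective
  have hc : Continuous e := continuous_subtype_val.comp (Homeomorph.unitBall (E := ℂ)).continuous
  have himage : ball (0 : ℂ) 1 \ S = e '' (e ⁻¹' S)ᶜ := by
    ext z
    constructor
    · rintro ⟨hz, hzS⟩
      refine ⟨Homeomorph.unitBall.symm ⟨z, hz⟩, ?_, ?_⟩ <;> simp [he, hzS]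
    · rintro ⟨x, hx, rfl⟩
      exact ⟨(Homeomorph.unitBall x).2, hx⟩
  rw [himage]
  exact ((hS.preimage hinj).isConnected_compl_of_one_lt_rank
    (by simp)).isPreconnected.image e hc.continuousOn

/-- A property of points which is locally constant on a preconnected set holds at all points of
this set if it holds at one of them. -/
theorem IsPreconnected.of_locally_iff {X : Type*} [TopologicalSpace X] {S : Set X}
    (hS : IsPreconnected S) {p : X → Prop} (hp : ∀ x ∈ S, ∀ᶠ y in 𝓝[S] x, (p y ↔ p x)) {x y : X}
    (hx : x ∈ S) (hy : y ∈ S) (hpx : p x) : p y := by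
  have : PreconnectedSpace S := isPreconnected_iff_preconnectedSpace.mp hS
  have hc : IsLocallyConstant fun z : S => p z := by
    refine (IsLocallyConstant.iff_eventually_eq _).mpr fun z => ?_
    have h := hp z z.2
    rw [nhdsWithin_eq_map_subtype_coe z.2, eventually_map] at h
    filter_upwards [h] with y hy using propext hy
  have h := hc.apply_eq_of_preconnectedSpace ⟨x, hx⟩ ⟨y, hy⟩
  exact h ▸ hpx

/-- On the ball of radius `ε` around `w`, the functions `σ i` are the different local inverses
of `f`, and they give all the preimages in the disk. -/
structure IsLocalSections (f : ℂ → ℂ) (w : ℂ) (ε : ℝ) {ι : Type} (σ : ι → ℂ → ℂ) : Prop where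
  pos : 0 < ε
  ball_subset : ball w ε ⊆ regularValues f
  analyticAt : ∀ i, ∀ y ∈ ball w ε, AnalyticAt ℂ (σ i) y
  mem : ∀ i, ∀ y ∈ ball w ε, σ i y ∈ ball (0 : ℂ) 1
  right_inv : ∀ i, ∀ y ∈ ball w ε, f (σ i y) = y
  injective : ∀ y ∈ ball w ε, Function.Injective fun i => σ i y
  exists_eq : ∀ y ∈ ball w ε, ∀ z ∈ ball (0 : ℂ) 1, f z = y → ∃ i, σ i y = z

theorem deriv_ne_zero_of_mem_regularValues {f : ℂ → ℂ} {z : ℂ} (hz : z ∈ ball (0 : ℂ) 1)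
    (h : f z ∈ regularValues f) : deriv f z ≠ 0 := fun h0 => h.2 ⟨z, hz, h0, rfl⟩

theorem IsLocalSections.eventually_eq {f : ℂ → ℂ} {w : ℂ} {ε : ℝ} {ι : Type} {σ : ι → ℂ → ℂ}
    (hσ : IsLocalSections f w ε σ) {z : ℂ} (hf : AnalyticAt ℂ f z) (hz : f z ∈ ball w ε) {i : ι}
    (hi : σ i (f z) = z) : ∀ᶠ x in 𝓝 z, σ i (f x) = x := by
  have hzm : z ∈ ball (0 : ℂ) 1 := hi ▸ hσ.mem i _ hz
  obtain ⟨g, -, -, -, hg⟩ := exists_local_inverse hf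
    (deriv_ne_zero_of_mem_regularValues hzm (hσ.ball_subset hz))
  have h1 : Tendsto (fun x => σ i (f x)) (𝓝 z) (𝓝 z) := by
    have := ((hσ.analyticAt i _ hz).continuousAt.comp hf.continuousAt).tendsto
    simpa only [Function.comp_def, hi] using this
  filter_upwards [hg, h1.eventually hg,
    hf.continuousAt.eventually_mem (isOpen_ball.mem_nhds hz)] with x hx hx' hxm
  rw [← hx', hσ.right_inv i _ hxm, hx]

namespace IsBlaschkeWith

variable {c : ℂ} {s : Multiset ℂ} {f : ℂ → ℂ}

theorem finite_diskCriticalValues (hf : IsBlaschkeWith c s f) (hs : s ≠ 0) :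
    (diskCriticalValues f).Finite := by
  refine ((hf.finite_critical_points hs).image f).subset ?_
  rintro w ⟨z, hz, hd, rfl⟩
  exact ⟨z, ⟨hz, hd⟩, rfl⟩

theorem isOpen_regularValues (hf : IsBlaschkeWith c s f) (hs : s ≠ 0) :
    IsOpen (regularValues f) :=
  isOpen_ball.sdiff (hf.finite_diskCriticalValues hs).isClosed

theorem isPreconnected_regularValues (hf : IsBlaschkeWith c s f) (hs : s ≠ 0) :
    IsPreconnected (regularValues f) :=
  isPreconnected_unit_ball_diff (hf.finite_diskCriticalValues hs).countable

theorem finite_ball_diff_regularPoints (hf : IsBlaschkeWith c s f) (hs : s ≠ 0) :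
    (ball (0 : ℂ) 1 \ regularPoints f).Finite := by
  have h : (⋃ w ∈ diskCriticalValues f, {z | z ∈ ball (0 : ℂ) 1 ∧ f z = w}).Finite := by
    refine (hf.finite_diskCriticalValues hs).biUnion fun w hw => ?_
    obtain ⟨z, hz, -, rfl⟩ := hw
    exact hf.finite_fiber (hf.mem_ball hs hz)
  refine h.subset fun z hz => ?_
  have hc : f z ∈ diskCriticalValues f := by
    by_contra hc
    exact hz.2 ⟨hz.1, hf.mem_ball hs hz.1, hc⟩
  exact mem_biUnion hc ⟨hz.1, rfl⟩

theorem regularPoints_eq_diff : regularPoints f = ball 0 1 \ (ball 0 1 \ regularPoints f) := by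
  rw [Set.sdiff_sdiff_cancel_left]
  exact fun z hz => hz.1

theorem isPreconnected_regularPoints (hf : IsBlaschkeWith c s f) (hs : s ≠ 0) :
    IsPreconnected (regularPoints f) := by
  rw [regularPoints_eq_diff]
  exact isPreconnected_unit_ball_diff (hf.finite_ball_diff_regularPoints hs).countable

/-- The local inverses at the points over `w` remain distinct nearby. They exhaust the nearby fibres
because all fibres over regular values have the same number of points. -/
theorem exists_isLocalSections (hf : IsBlaschkeWith c s f) (hs : s ≠ 0) {w : ℂ}
    (hw : w ∈ regularValues f) :
    ∃ (ε : ℝ) (ι : Type) (σ : ι → ℂ → ℂ), Finite ι ∧ IsLocalSections f w ε σ := by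
  have hncard : ∀ y ∈ regularValues f,
      {z | z ∈ ball (0 : ℂ) 1 ∧ f z = y}.ncard = Multiset.card s := fun y hy =>
    hf.ncard_fiber hy.1 fun z hz hzy => deriv_ne_zero_of_mem_regularValues hz (hzy ▸ hy)
  let F : Set ℂ := {z | z ∈ ball (0 : ℂ) 1 ∧ f z = w}
  have hF : Finite F := hf.finite_fiber hw.1
  have hex : ∀ p : F, ∃ g : ℂ → ℂ, AnalyticAt ℂ g w ∧ g w = p ∧ ∀ᶠ y in 𝓝 w, f (g y) = y := by
    rintro ⟨p, hp, rfl⟩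
    obtain ⟨g, hg, hgp, h, -⟩ := exists_local_inverse (hf.analyticAt hp)
      (deriv_ne_zero_of_mem_regularValues hp hw)
    exact ⟨g, hg, hgp, h⟩
  choose g hg hgp hfg using hex
  have hev : ∀ᶠ y in 𝓝 w, y ∈ regularValues f ∧ (∀ p, AnalyticAt ℂ (g p) y) ∧
      (∀ p, g p y ∈ ball (0 : ℂ) 1) ∧ (∀ p, f (g p y) = y) ∧
      ∀ p q, p ≠ q → g p y ≠ g q y := by
    refine Eventually.and ((hf.isOpen_regularValues hs).mem_nhds hw) ((eventually_all.mpr fun p =>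
      (hg p).eventually_analyticAt).and ((eventually_all.mpr fun p => ?_).and
      ((eventually_all.mpr hfg).and (eventually_all.mpr fun p => eventually_all.mpr fun q => ?_))))
    · exact (hg p).continuousAt.eventually_mem (by rw [hgp]; exact isOpen_ball.mem_nhds p.2.1)
    · by_cases hpq : p = q
      · simp [hpq]
      · have h : g p w ≠ g q w := by
          rw [hgp, hgp]
          exact fun h => hpq (Subtype.ext h)
        filter_upwards [((hg p).continuousAt.ne_iff_eventually_ne (hg q).continuousAt).mp h]
          with y hy _ using hy
  obtain ⟨ε, hε, h⟩ := Metric.eventually_nhds_iff_ball.mp hev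
  refine ⟨ε, F, g, hF, hε, fun y hy => (h y hy).1, fun i y hy => (h y hy).2.1 i,
    fun i y hy => (h y hy).2.2.1 i, fun i y hy => (h y hy).2.2.2.1 i, fun y hy p q hpq => ?_,
    fun y hy z hz hzy => ?_⟩
  · by_contra hne
    exact (h y hy).2.2.2.2 p q hne hpq
  · have hinj : Function.Injective fun p => g p y := fun p q hpq => by
      by_contra hne
      exact (h y hy).2.2.2.2 p q hne hpq
    have hsub : range (fun p => g p y) ⊆ {z | z ∈ ball (0 : ℂ) 1 ∧ f z = y} := by
      rintro _ ⟨p, rfl⟩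
      exact ⟨(h y hy).2.2.1 p, (h y hy).2.2.2.1 p⟩
    have hcard : (range fun p => g p y).ncard = Multiset.card s := by
      rw [← hncard w hw, ← Nat.card_coe_set_eq, Nat.card_range_of_injective hinj]
      exact Nat.card_coe_set_eq F
    have heq := eq_of_subset_of_ncard_le hsub
      (by rw [hcard, hncard y (h y hy).1]) (hf.finite_fiber (h y hy).1.1)
    have : z ∈ range fun p => g p y := heq ▸ ⟨hz, hzy⟩
    exact this

/-- The restriction of a finite Blaschke product to the regular points. -/
def regularMap (f : ℂ → ℂ) (z : regularPoints f) : regularValues f := ⟨f z, z.2.2⟩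

theorem continuous_regularMap (hf : IsBlaschkeWith c s f) : Continuous (regularMap f) :=
  (hf.differentiableOn.continuousOn.mono fun _ hz => hz.1).domRestrict.subtype_mk _

/-- The sheets are the images of the local sections; the index of the section through a point is
locally constant, which makes the trivialization continuous. -/
theorem isCoveringMap_regularMap (hf : IsBlaschkeWith c s f) (hs : s ≠ 0) :
    IsCoveringMap (regularMap f) := by
  rintro ⟨w, hw⟩
  obtain ⟨ε, ι, σ, hι, hσ⟩ := hf.exists_isLocalSections hs hw
  let _ : TopologicalSpace ι := ⊥
  have : DiscreteTopology ι := ⟨rfl⟩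
  refine IsEvenlyCovered.to_isEvenlyCovered_preimage (I := ι) ⟨inferInstance, ?_⟩
  set U : Set (regularValues f) := Subtype.val ⁻¹' ball w ε with hU
  have hUo : IsOpen U := isOpen_ball.preimage continuous_subtype_val
  have hex : ∀ z : regularMap f ⁻¹' U, ∃ i, σ i (f z) = z := fun z =>
    hσ.exists_eq _ z.2 _ z.1.2.1 rfl
  choose idx hidx using hex
  have hidx_cont : Continuous idx := by
    refine IsLocallyConstant.continuous ((IsLocallyConstant.iff_eventually_eq _).mpr fun z => ?_)
    have h := hσ.eventually_eq (hf.analyticAt z.1.2.1) z.2 (hidx z)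
    filter_upwards [(continuous_subtype_val.comp continuous_subtype_val).continuousAt.eventually h]
      with x hx
    exact hσ.injective _ x.2 ((hidx x).trans hx.symm)
  refine ⟨U, mem_ball_self hσ.pos, hUo, hUo.preimage hf.continuous_regularMap, ?_⟩
  refine ⟨{
    toFun := fun z => (⟨regularMap f z, z.2⟩, idx z)
    invFun := fun x => ⟨⟨σ x.2 x.1, hσ.mem _ _ x.1.2, by rw [hσ.right_inv _ _ x.1.2]; exact x.1.1.2⟩,
      by change f (σ x.2 x.1) ∈ ball w ε; rw [hσ.right_inv _ _ x.1.2]; exact x.1.2⟩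
    left_inv := ?_
    right_inv := ?_
    continuous_toFun := ?_
    continuous_invFun := ?_ }, fun z => rfl⟩
  · intro z
    exact Subtype.ext (Subtype.ext (hidx z))
  · rintro ⟨y, i⟩
    have h1 : f (σ i y) = y := hσ.right_inv _ _ y.2
    refine Prod.ext (Subtype.ext (Subtype.ext h1)) ?_
    refine hσ.injective y y.2 ?_
    have h2 := hidx ⟨⟨σ i y, hσ.mem _ _ y.2, by rw [h1]; exact y.1.2⟩,
      by change f (σ i y) ∈ ball w ε; rw [h1]; exact y.2⟩
    simp only [h1] at h2
    exact h2
  · exact ((hf.continuous_regularMap.comp continuous_subtype_val).subtype_mk _).prodMk hidx_cont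
  · refine Continuous.subtype_mk (Continuous.subtype_mk ?_ _) _
    refine continuous_prod_of_discrete_right.mpr fun i => continuous_iff_continuousAt.mpr fun y => ?_
    have hc : Continuous fun y : U => ((y : regularValues f) : ℂ) :=
      continuous_subtype_val.comp continuous_subtype_val
    exact ContinuousAt.comp (f := fun y : U => ((y : regularValues f) : ℂ))
      (hσ.analyticAt i y y.2).continuousAt hc.continuousAt

theorem exists_lift (hf : IsBlaschkeWith c s f) (hs : s ≠ 0) {γ : unitInterval → ℂ}
    (hγ : Continuous γ) (hγm : ∀ t, γ t ∈ regularValues f) {z : ℂ} (hz : z ∈ ball (0 : ℂ) 1)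
    (h0 : f z = γ 0) :
    ∃ L : unitInterval → ℂ, Continuous L ∧ L 0 = z ∧ ∀ t, L t ∈ ball (0 : ℂ) 1 ∧ f (L t) = γ t := by
  obtain ⟨L, hL, hL0⟩ := (hf.isCoveringMap_regularMap hs).exists_path_lifts
    ⟨fun t => ⟨γ t, hγm t⟩, hγ.subtype_mk _⟩ ⟨z, hz, h0 ▸ hγm 0⟩ (Subtype.ext h0.symm)
  refine ⟨fun t => L t, continuous_subtype_val.comp L.continuous, congrArg Subtype.val hL0,
    fun t => ⟨(L t).2.1, ?_⟩⟩
  exact congrArg Subtype.val (congrFun hL t)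

theorem lift_unique (hf : IsBlaschkeWith c s f) (hs : s ≠ 0) {L L' : unitInterval → ℂ}
    (hL : Continuous L) (hL' : Continuous L') (hm : ∀ t, L t ∈ regularPoints f)
    (hm' : ∀ t, L' t ∈ regularPoints f) (h : ∀ t, f (L t) = f (L' t)) {t₀ : unitInterval}
    (h0 : L t₀ = L' t₀) : L = L' := by
  have := (hf.isCoveringMap_regularMap hs).eq_of_comp_eq (hL.subtype_mk hm) (hL'.subtype_mk hm')
    (funext fun t => Subtype.ext (h t)) t₀ (Subtype.ext h0)
  exact funext fun t => congrArg Subtype.val (congrFun this t)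

end IsBlaschkeWith
end

/-! ### Continuation of an equivalence relation on the zeros -/

noncomputable section

/-- The pairs of regular points in the same fibre of `f`. -/
def fiberPairs (f : ℂ → ℂ) : Set (ℂ × ℂ) :=
  {x | x.1 ∈ regularPoints f ∧ x.2 ∈ regularPoints f ∧ f x.1 = f x.2}

/-- An equivalence relation on the fibre of `f` over `0` which is preserved by continuation. -/
structure IsZeroFiberRel (f : ℂ → ℂ) (S : ℂ → ℂ → Prop) : Prop where
  refl : ∀ p ∈ ball (0 : ℂ) 1, f p = 0 → S p p
  symm : ∀ p q, S p q → S q p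
  trans : ∀ p q r, S p q → S q r → S p r
  invariant : ∀ p q p' q', f p = 0 → f p' = 0 → JoinedIn (fiberPairs f) (p, q) (p', q') →
    S p q → S p' q'

/-- A relation which is an equivalence on all fibres of `f` over regular values and is locally
constant along local sections. -/
structure IsFiberRel (f : ℂ → ℂ) (R : ℂ → ℂ → Prop) : Prop where
  refl : ∀ z ∈ regularPoints f, R z z
  symm : ∀ z ∈ regularPoints f, ∀ z' ∈ regularPoints f, f z = f z' → R z z' → R z' z
  trans : ∀ z ∈ regularPoints f, ∀ z' ∈ regularPoints f, ∀ z'' ∈ regularPoints f, f z = f z' →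
    f z' = f z'' → R z z' → R z' z'' → R z z''
  locally_const : ∀ {w : ℂ} {ε : ℝ} {ι : Type} {σ : ι → ℂ → ℂ}, IsLocalSections f w ε σ →
    ∀ i j, ∀ y ∈ ball w ε, ∀ y' ∈ ball w ε, R (σ i y) (σ j y) → R (σ i y') (σ j y')

/-- The relation on the fibres of `f` obtained from one on the fibre over `0` by continuation. -/
def continuedRel (f : ℂ → ℂ) (S : ℂ → ℂ → Prop) (z z' : ℂ) : Prop :=
  ∃ p q, f p = 0 ∧ S p q ∧ JoinedIn (fiberPairs f) (z, z') (p, q)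

theorem IsLocalSections.mem_regularPoints {f : ℂ → ℂ} {w : ℂ} {ε : ℝ} {ι : Type}
    {σ : ι → ℂ → ℂ} (hσ : IsLocalSections f w ε σ) (i : ι) {y : ℂ} (hy : y ∈ ball w ε) :
    σ i y ∈ regularPoints f :=
  ⟨hσ.mem i y hy, by rw [hσ.right_inv i y hy]; exact hσ.ball_subset hy⟩

theorem IsLocalSections.joinedIn {f : ℂ → ℂ} {w : ℂ} {ε : ℝ} {ι : Type}
    {σ : ι → ℂ → ℂ} (hσ : IsLocalSections f w ε σ) (i j : ι) {y y' : ℂ} (hy : y ∈ ball w ε)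
    (hy' : y' ∈ ball w ε) :
    JoinedIn (fiberPairs f) (σ i y, σ j y) (σ i y', σ j y') := by
  have h : IsPathConnected ((fun y => (σ i y, σ j y)) '' ball w ε) := by
    refine ((convex_ball w ε).isPathConnected ⟨y, hy⟩).image' fun x hx => ?_
    exact ((hσ.analyticAt i x hx).continuousAt.prodMk
      (hσ.analyticAt j x hx).continuousAt).continuousWithinAt
  refine (h.joinedIn _ ⟨y, hy, rfl⟩ _ ⟨y', hy', rfl⟩).mono ?_
  rintro _ ⟨x, hx, rfl⟩
  exact ⟨hσ.mem_regularPoints i hx, hσ.mem_regularPoints j hx, by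
    simp only [hσ.right_inv _ x hx]⟩

theorem continuedRel_of_joinedIn {f : ℂ → ℂ} {S : ℂ → ℂ → Prop} {z z' x x' : ℂ}
    (h : JoinedIn (fiberPairs f) (z, z') (x, x')) (hx : continuedRel f S z z') :
    continuedRel f S x x' := by
  obtain ⟨p, q, hp, hpq, hj⟩ := hx
  exact ⟨p, q, hp, hpq, h.symm.trans hj⟩

theorem continuedRel_iff {f : ℂ → ℂ} {S : ℂ → ℂ → Prop} (hS : IsZeroFiberRel f S) {p q : ℂ}
    (hp : p ∈ regularPoints f) (hq : q ∈ regularPoints f) (hp0 : f p = 0) (hq0 : f q = 0) :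
    continuedRel f S p q ↔ S p q := by
  constructor
  · rintro ⟨p', q', hp', h, hj⟩
    exact hS.invariant p' q' p q hp' hp0 hj.symm h
  · exact fun h => ⟨p, q, hp0, h, JoinedIn.refl ⟨hp, hq, hp0.trans hq0.symm⟩⟩

/-- A relation holding the equivalence laws on the fibre over `w`. -/
structure IsEquivOnFiber (f : ℂ → ℂ) (R : ℂ → ℂ → Prop) (w : ℂ) : Prop where
  refl : ∀ z ∈ ball (0 : ℂ) 1, f z = w → R z z
  symm : ∀ z ∈ ball (0 : ℂ) 1, ∀ z' ∈ ball (0 : ℂ) 1, f z = w → f z' = w → R z z' → R z' z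
  trans : ∀ z ∈ ball (0 : ℂ) 1, ∀ z' ∈ ball (0 : ℂ) 1, ∀ z'' ∈ ball (0 : ℂ) 1, f z = w →
    f z' = w → f z'' = w → R z z' → R z' z'' → R z z''

namespace IsBlaschkeWith

variable {c : ℂ} {s : Multiset ℂ} {f : ℂ → ℂ}

/-- Paths of pairs with different projections cannot be concatenated to prove transitivity. Instead,
validity of the equivalence laws on a fibre is a locally constant property of the base point; it
holds over 0, and the regular values are connected. -/
theorem isFiberRel_continuedRel (hf : IsBlaschkeWith c s f) (hs : s ≠ 0)
    (h0 : (0 : ℂ) ∈ regularValues f) {S : ℂ → ℂ → Prop} (hS : IsZeroFiberRel f S) :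
    IsFiberRel f (continuedRel f S) := by
  have hloc : ∀ {w : ℂ} {ε : ℝ} {ι : Type} {σ : ι → ℂ → ℂ}, IsLocalSections f w ε σ →
      ∀ i j, ∀ y ∈ ball w ε, ∀ y' ∈ ball w ε, continuedRel f S (σ i y) (σ j y) →
        continuedRel f S (σ i y') (σ j y') := fun hσ i j y hy y' hy' h =>
    continuedRel_of_joinedIn (hσ.joinedIn i j hy hy') h
  have hzero : IsEquivOnFiber f (continuedRel f S) 0 := by
    have hreg : ∀ z ∈ ball (0 : ℂ) 1, f z = 0 → z ∈ regularPoints f := fun z hz hfz =>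
      ⟨hz, hfz ▸ h0⟩
    refine ⟨fun z hz hfz => ?_, fun z hz z' hz' hfz hfz' => ?_,
      fun z hz z' hz' z'' hz'' hfz hfz' hfz'' => ?_⟩
    · rw [continuedRel_iff hS (hreg z hz hfz) (hreg z hz hfz) hfz hfz]
      exact hS.refl z hz hfz
    · rw [continuedRel_iff hS (hreg z hz hfz) (hreg z' hz' hfz') hfz hfz',
        continuedRel_iff hS (hreg z' hz' hfz') (hreg z hz hfz) hfz' hfz]
      exact hS.symm z z'
    · rw [continuedRel_iff hS (hreg z hz hfz) (hreg z' hz' hfz') hfz hfz',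
        continuedRel_iff hS (hreg z' hz' hfz') (hreg z'' hz'' hfz'') hfz' hfz'',
        continuedRel_iff hS (hreg z hz hfz) (hreg z'' hz'' hfz'') hfz hfz'']
      exact hS.trans z z' z''
  have hall : ∀ w ∈ regularValues f, IsEquivOnFiber f (continuedRel f S) w := by
    intro w hw
    refine (hf.isPreconnected_regularValues hs).of_locally_iff (fun x hx => ?_) h0 hw hzero
    obtain ⟨ε, ι, σ, -, hσ⟩ := hf.exists_isLocalSections hs hx
    have key : ∀ y ∈ ball x ε, ∀ y' ∈ ball x ε, IsEquivOnFiber f (continuedRel f S) y →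
        IsEquivOnFiber f (continuedRel f S) y' := by
      intro y hy y' hy' h
      refine ⟨fun z hz hfz => ?_, fun z hz z' hz' hfz hfz' hzz' => ?_,
        fun z hz z' hz' z'' hz'' hfz hfz' hfz'' h1 h2 => ?_⟩
      · obtain ⟨i, rfl⟩ := hσ.exists_eq y' hy' z hz hfz
        exact hloc hσ i i y hy y' hy' (h.refl _ (hσ.mem i y hy) (hσ.right_inv i y hy))
      · obtain ⟨i, rfl⟩ := hσ.exists_eq y' hy' z hz hfz
        obtain ⟨j, rfl⟩ := hσ.exists_eq y' hy' z' hz' hfz'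
        exact hloc hσ j i y hy y' hy' (h.symm _ (hσ.mem i y hy) _ (hσ.mem j y hy)
          (hσ.right_inv i y hy) (hσ.right_inv j y hy) (hloc hσ i j y' hy' y hy hzz'))
      · obtain ⟨i, rfl⟩ := hσ.exists_eq y' hy' z hz hfz
        obtain ⟨j, rfl⟩ := hσ.exists_eq y' hy' z' hz' hfz'
        obtain ⟨k, rfl⟩ := hσ.exists_eq y' hy' z'' hz'' hfz''
        exact hloc hσ i k y hy y' hy' (h.trans _ (hσ.mem i y hy) _ (hσ.mem j y hy)
          _ (hσ.mem k y hy) (hσ.right_inv i y hy) (hσ.right_inv j y hy) (hσ.right_inv k y hy)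
          (hloc hσ i j y' hy' y hy h1) (hloc hσ j k y' hy' y hy h2))
    filter_upwards [mem_nhdsWithin_of_mem_nhds (ball_mem_nhds x hσ.pos)] with y hy
    exact ⟨key y hy x (mem_ball_self hσ.pos), key x (mem_ball_self hσ.pos) y hy⟩
  exact ⟨fun z hz => (hall _ hz.2).refl z hz.1 rfl,
    fun z hz z' hz' h => (hall _ hz.2).symm z hz.1 z' hz'.1 rfl h.symm,
    fun z hz z' hz' z'' hz'' h h' => (hall _ hz.2).trans z hz.1 z' hz'.1 z'' hz''.1 rfl h.symm
      (h'.symm.trans h.symm), hloc⟩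

/-! ### Products over equivalence classes -/

open Classical in
/-- The finite set of the points related to `z` in the fibre of `z`. -/
def fiberClass (c : ℂ) (s : Multiset ℂ) (f : ℂ → ℂ) (R : ℂ → ℂ → Prop) (z : ℂ) : Finset ℂ :=
  (fiberPoly c s (f z)).roots.toFinset.filter (R z)

/-- The product of the points related to `z` in the fibre of `z`. -/
def classProd (c : ℂ) (s : Multiset ℂ) (f : ℂ → ℂ) (R : ℂ → ℂ → Prop) (z : ℂ) : ℂ :=
  ∏ x ∈ fiberClass c s f R z, x

theorem mem_fiberClass (hf : IsBlaschkeWith c s f) {R : ℂ → ℂ → Prop} {z : ℂ}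
    (hz : z ∈ regularPoints f) {x : ℂ} :
    x ∈ fiberClass c s f R z ↔ x ∈ ball (0 : ℂ) 1 ∧ f x = f z ∧ R z x := by
  classical
  rw [fiberClass, Finset.mem_filter, Multiset.mem_toFinset, hf.mem_roots_fiberPoly hz.2.1,
    and_assoc]

theorem fiberClass_eq (hf : IsBlaschkeWith c s f) {R : ℂ → ℂ → Prop} (hR : IsFiberRel f R)
    {z x : ℂ} (hz : z ∈ regularPoints f) (hx : x ∈ fiberClass c s f R z) :
    fiberClass c s f R x = fiberClass c s f R z := by
  obtain ⟨hxm, hfx, hzx⟩ := (hf.mem_fiberClass hz).mp hx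
  have hxr : x ∈ regularPoints f := ⟨hxm, hfx ▸ hz.2⟩
  ext y
  rw [hf.mem_fiberClass hz, hf.mem_fiberClass hxr, hfx]
  refine and_congr_right fun hym => and_congr_right fun hfy => ?_
  have hyr : y ∈ regularPoints f := ⟨hym, hfy ▸ hz.2⟩
  exact ⟨hR.trans z hz x hxr y hyr hfx.symm (hfx.trans hfy.symm) hzx,
    hR.trans x hxr z hz y hyr hfx hfy.symm (hR.symm z hz x hxr hfx.symm hzx)⟩

theorem norm_classProd_le_one (hf : IsBlaschkeWith c s f) {R : ℂ → ℂ → Prop} {z : ℂ}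
    (hz : z ∈ regularPoints f) : ‖classProd c s f R z‖ ≤ 1 := by
  rw [classProd, norm_prod]
  exact Finset.prod_le_one (fun _ _ => norm_nonneg _) fun x hx =>
    (mem_ball_zero_iff.mp ((hf.mem_fiberClass hz).mp hx).1).le

/-- By Vieta `‖f z‖` is the modulus of the product of the whole fibre, and the points outside the
class contribute a factor at most 1. -/
theorem norm_le_norm_classProd (hf : IsBlaschkeWith c s f) (hf0 : f 0 = 0) {R : ℂ → ℂ → Prop}
    {z : ℂ} (hz : z ∈ regularPoints f) : ‖f z‖ ≤ ‖classProd c s f R z‖ := by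
  classical
  have hnd := hf.nodup_roots_fiberPoly hz.2.1 fun x hx hfx =>
    deriv_ne_zero_of_mem_regularValues hx (hfx ▸ hz.2)
  have h1 : (fiberPoly c s (f z)).roots.prod = ∏ x ∈ (fiberPoly c s (f z)).roots.toFinset, x := by
    rw [Finset.prod, Multiset.toFinset_val, hnd.dedup, Multiset.map_id']
  rw [← hf.norm_prod_roots_fiberPoly hz.2.1 hf0, h1,
    ← Finset.prod_filter_mul_prod_filter_not _ (R z), norm_mul]
  refine (mul_le_mul_of_nonneg_left ?_ (norm_nonneg _)).trans_eq (mul_one _)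
  rw [norm_prod]
  refine Finset.prod_le_one (fun _ _ => norm_nonneg _) fun x hx => ?_
  have := (hf.mem_roots_fiberPoly hz.2.1).mp (Multiset.mem_toFinset.mp (Finset.mem_filter.mp hx).1)
  exact (mem_ball_zero_iff.mp this.1).le

/-- Near a regular point the classes are given by local sections. -/
theorem exists_fiberClass_eq_image (hf : IsBlaschkeWith c s f) (hs : s ≠ 0) {R : ℂ → ℂ → Prop}
    (hR : IsFiberRel f R) {z : ℂ} (hz : z ∈ regularPoints f) :
    ∃ (ι : Type) (σ : ι → ℂ → ℂ) (A : Finset ι), (∀ i, AnalyticAt ℂ (σ i) (f z)) ∧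
      ∀ᶠ x in 𝓝 z, Function.Injective (fun i => σ i (f x)) ∧
        ∀ y, y ∈ fiberClass c s f R x ↔ ∃ i ∈ A, σ i (f x) = y := by
  classical
  obtain ⟨ε, ι, σ, hι, hσ⟩ := hf.exists_isLocalSections hs hz.2
  have : Fintype ι := Fintype.ofFinite ι
  have hw := mem_ball_self (x := f z) hσ.pos
  obtain ⟨i, hi⟩ := hσ.exists_eq _ hw z hz.1 rfl
  refine ⟨ι, σ, Finset.univ.filter fun j => R (σ i (f z)) (σ j (f z)),
    fun j => hσ.analyticAt j _ hw, ?_⟩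
  filter_upwards [hσ.eventually_eq (hf.analyticAt hz.1) hw hi,
    (hf.analyticAt hz.1).continuousAt.eventually_mem (isOpen_ball.mem_nhds hw)] with x hx hxm
  have hxr : x ∈ regularPoints f := hx ▸ hσ.mem_regularPoints i hxm
  refine ⟨hσ.injective _ hxm, fun y => ?_⟩
  rw [hf.mem_fiberClass hxr]
  constructor
  · rintro ⟨hym, hfy, hxy⟩
    obtain ⟨j, hj⟩ := hσ.exists_eq _ hxm y hym hfy
    refine ⟨j, ?_, hj⟩
    rw [Finset.mem_filter]
    refine ⟨Finset.mem_univ j, hR.locally_const hσ i j _ hxm _ hw ?_⟩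
    rwa [hx, hj]
  · rintro ⟨j, hjA, rfl⟩
    refine ⟨hσ.mem j _ hxm, hσ.right_inv j _ hxm, ?_⟩
    have := hR.locally_const hσ i j _ hw _ hxm (Finset.mem_filter.mp hjA).2
    rwa [hx] at this

theorem differentiableAt_classProd (hf : IsBlaschkeWith c s f) (hs : s ≠ 0) {R : ℂ → ℂ → Prop}
    (hR : IsFiberRel f R) {z : ℂ} (hz : z ∈ regularPoints f) :
    DifferentiableAt ℂ (classProd c s f R) z := by
  classical
  obtain ⟨ι, σ, A, hσ, h⟩ := hf.exists_fiberClass_eq_image hs hR hz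
  have hd : DifferentiableAt ℂ (fun x => ∏ i ∈ A, σ i (f x)) z :=
    DifferentiableAt.fun_finsetProd fun i _ =>
      (hσ i).differentiableAt.comp z (hf.analyticAt hz.1).differentiableAt
  refine hd.congr_of_eventuallyEq ?_
  filter_upwards [h] with x hx
  have himage : fiberClass c s f R x = A.image fun i => σ i (f x) := by
    ext y
    rw [hx.2, Finset.mem_image]
  rw [classProd, himage, Finset.prod_image hx.1.injOn]

theorem card_fiberClass_eq (hf : IsBlaschkeWith c s f) (hs : s ≠ 0) {R : ℂ → ℂ → Prop}
    (hR : IsFiberRel f R) {z z' : ℂ} (hz : z ∈ regularPoints f) (hz' : z' ∈ regularPoints f) :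
    (fiberClass c s f R z).card = (fiberClass c s f R z').card := by
  classical
  refine (hf.isPreconnected_regularPoints hs).of_locally_iff
    (p := fun x => (fiberClass c s f R x).card = (fiberClass c s f R z').card)
    (fun x hx => ?_) hz' hz rfl
  obtain ⟨ι, σ, A, hσ, h⟩ := hf.exists_fiberClass_eq_image hs hR hx
  have hcard : ∀ᶠ y in 𝓝 x, (fiberClass c s f R y).card = A.card := by
    filter_upwards [h] with y hy
    have himage : fiberClass c s f R y = A.image fun i => σ i (f y) := by
      ext u
      rw [hy.2, Finset.mem_image]
    rw [himage, Finset.card_image_of_injective _ hy.1]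
  filter_upwards [mem_nhdsWithin_of_mem_nhds hcard] with y hy
  rw [show (fiberClass c s f R y).card = A.card from hy, hcard.self_of_nhds]

end IsBlaschkeWith

/-! ### Removable singularities and the right factor -/

theorem eventually_mem_of_finite_diff {V : Set ℂ} (hfin : (ball (0 : ℂ) 1 \ V).Finite) {z : ℂ}
    (hz : z ∈ ball (0 : ℂ) 1) : ∀ᶠ x in 𝓝[≠] z, x ∈ V := by
  have h1 : ((ball (0 : ℂ) 1 \ V) \ {z})ᶜ ∈ 𝓝 z :=
    (hfin.subset sdiff_subset).isClosed.isOpen_compl.mem_nhds (by simp)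
  filter_upwards [self_mem_nhdsWithin, mem_nhdsWithin_of_mem_nhds h1,
    mem_nhdsWithin_of_mem_nhds (isOpen_ball.mem_nhds hz)] with x hx hx1 hx2
  by_contra hxV
  exact hx1 ⟨⟨hx2, hxV⟩, hx⟩

theorem le_on_ball_of_le_off_finite {u v : ℂ → ℝ} {V : Set ℂ}
    (hfin : (ball (0 : ℂ) 1 \ V).Finite) (hu : ContinuousOn u (ball 0 1))
    (hv : ContinuousOn v (ball 0 1)) (h : ∀ z ∈ V, u z ≤ v z) {z : ℂ}
    (hz : z ∈ ball (0 : ℂ) 1) : u z ≤ v z :=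
  le_of_eventually_le_punctured (hu.continuousAt (isOpen_ball.mem_nhds hz))
    (hv.continuousAt (isOpen_ball.mem_nhds hz))
    ((eventually_mem_of_finite_diff hfin hz).mono h)

/-- Removable singularities at finitely many points of the disk. -/
theorem exists_differentiableOn_extension {V : Set ℂ}
    (hfin : (ball (0 : ℂ) 1 \ V).Finite) {g : ℂ → ℂ} (hg : ∀ z ∈ V, DifferentiableAt ℂ g z)
    {C : ℝ} (hC : ∀ z ∈ V, ‖g z‖ ≤ C) :
    ∃ G : ℂ → ℂ, DifferentiableOn ℂ G (ball 0 1) ∧ EqOn G g V := by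
  have heq : ∀ z ∈ V, limUnder (𝓝[≠] z) g = g z := fun z hz =>
    ((hg z hz).continuousAt.tendsto.mono_left nhdsWithin_le_nhds).limUnder_eq
  refine ⟨fun z => limUnder (𝓝[≠] z) g, fun z hz => ?_, heq⟩
  have hnhds : insert z V ∈ 𝓝 z := by
    have := eventually_mem_of_finite_diff hfin hz
    rw [eventually_nhdsWithin_iff] at this
    filter_upwards [this] with x hx
    by_cases hxz : x = z
    · exact Or.inl hxz
    · exact Or.inr (hx hxz)
  have hsub : insert z V \ {z} ⊆ V := by
    rintro x ⟨hx | hx, hxz⟩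
    · exact absurd hx hxz
    · exact hx
  have h := Complex.differentiableOn_update_limUnder_of_bddAbove hnhds
    (fun x hx => (hg x (hsub hx)).differentiableWithinAt)
    ⟨C, by rintro _ ⟨x, hx, rfl⟩; exact hC x (hsub hx)⟩
  refine ((h.differentiableAt hnhds).congr_of_eventuallyEq ?_).differentiableWithinAt
  filter_upwards [hnhds] with x hx
  by_cases hxz : x = z
  · subst hxz
    simp
  · rw [Function.update_of_ne hxz]
    exact heq x (hsub ⟨hx, hxz⟩)

namespace IsBlaschkeWith

variable {c : ℂ} {s : Multiset ℂ} {f : ℂ → ℂ}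

theorem nodup_zeros (hf : IsBlaschkeWith c s f)
    (h : ∀ a ∈ ball (0 : ℂ) 1, f a = 0 → deriv f a ≠ 0) : s.Nodup := by
  have h1 := hf.nodup_roots_fiberPoly (w := 0) (by simp) h
  have hc : c ≠ 0 := norm_ne_zero_iff.mp (by rw [hf.norm_const]; norm_num)
  have h2 : fiberPoly c s 0 = Polynomial.C c * blaschkeNum s := by simp [fiberPoly]
  rw [h2, Polynomial.roots_C_mul _ hc, blaschkeNum, Polynomial.roots_multiset_prod_X_sub_C] at h1
  exact h1

/-- Here `b` extends the class product across the finitely many nonregular points. It is constant on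
classes by construction; that it separates them follows by counting. -/
theorem exists_of_isFiberRel (hf : IsBlaschkeWith c s f) (hf0 : f 0 = 0)
    (hsimple : ∀ a ∈ ball (0 : ℂ) 1, f a = 0 → deriv f a ≠ 0) {R : ℂ → ℂ → Prop}
    (hR : IsFiberRel f R) :
    ∃ d t b, IsBlaschkeWith d t b ∧ t.Nodup ∧
      (∀ a, a ∈ t ↔ a ∈ ball (0 : ℂ) 1 ∧ f a = 0 ∧ R 0 a) ∧
      ∀ z ∈ regularPoints f, ∀ z' ∈ ball (0 : ℂ) 1, b z = b z' ↔ f z = f z' ∧ R z z' := by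
  classical
  have h0s : (0 : ℂ) ∈ s := (hf.eq_zero_iff (by simp)).mp hf0
  have hs : s ≠ 0 := fun h => by simp [h] at h0s
  have hreg0 : (0 : ℂ) ∈ regularValues f :=
    ⟨by simp, fun ⟨z, hz, hd, hfz⟩ => hsimple z hz hfz hd⟩
  have h0 : (0 : ℂ) ∈ regularPoints f := ⟨by simp, hf0.symm ▸ hreg0⟩
  have hfin := hf.finite_ball_diff_regularPoints hs
  obtain ⟨b, hbd, hb⟩ := exists_differentiableOn_extension hfin
    (fun z hz => hf.differentiableAt_classProd hs hR hz)
    (fun z hz => hf.norm_classProd_le_one (R := R) hz)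
  have hb1 : ∀ z ∈ ball (0 : ℂ) 1, ‖b z‖ ≤ 1 := fun z hz =>
    le_on_ball_of_le_off_finite hfin hbd.continuousOn.norm continuousOn_const
      (fun x hx => by rw [hb hx]; exact hf.norm_classProd_le_one hx) hz
  have hb2 : ∀ z ∈ ball (0 : ℂ) 1, ‖blaschkeProd s z‖ ≤ ‖b z‖ := fun z hz => by
    rw [← hf.norm_eq hz]
    exact le_on_ball_of_le_off_finite hfin hf.differentiableOn.continuousOn.norm
      hbd.continuousOn.norm
      (fun x hx => by rw [hb hx]; exact hf.norm_le_norm_classProd hf0 hx) hz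
  obtain ⟨d, t, hts, hbt⟩ := exists_isBlaschkeWith_of_blaschkeProd_le hf.zeros_mem hbd hb1 hb2
  have htmem : ∀ a, a ∈ t ↔ a ∈ ball (0 : ℂ) 1 ∧ f a = 0 ∧ R 0 a := by
    have key : ∀ a ∈ ball (0 : ℂ) 1, f a = 0 → (a ∈ t ↔ R 0 a) := by
      intro a ha hfa
      have hareg : a ∈ regularPoints f := ⟨ha, hfa.symm ▸ hreg0⟩
      -- A product of points vanishes exactly when 0 is one of them, that is, when `a` is related to
      -- 0.
      rw [← hbt.eq_zero_iff ha, hb hareg, classProd, Finset.prod_eq_zero_iff]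
      constructor
      · rintro ⟨x, hx, rfl⟩
        exact hR.symm a hareg _ h0 (hfa.trans hf0.symm) ((hf.mem_fiberClass hareg).mp hx).2.2
      · intro h
        exact ⟨0, (hf.mem_fiberClass hareg).mpr ⟨by simp, hf0.trans hfa.symm,
          hR.symm _ h0 _ hareg (hf0.trans hfa.symm) h⟩, rfl⟩
    intro a
    constructor
    · intro hat
      have has := Multiset.mem_of_le hts hat
      have ha := hf.zeros_mem a has
      have hfa := (hf.eq_zero_iff ha).mpr has
      exact ⟨ha, hfa, (key a ha hfa).mp hat⟩
    · rintro ⟨ha, hfa, h⟩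
      exact (key a ha hfa).mpr h
  have htnd : t.Nodup := Multiset.nodup_of_le hts (hf.nodup_zeros hsimple)
  have ht0 : t ≠ 0 := by
    intro h
    have := (htmem 0).mpr ⟨by simp, hf0, hR.refl 0 h0⟩
    simp [h] at this
  have hcard : Multiset.card t = (fiberClass c s f R 0).card := by
    rw [← Multiset.toFinset_card_of_nodup htnd]
    congr 1
    ext a
    rw [Multiset.mem_toFinset, htmem, hf.mem_fiberClass h0, hf0]
  have hfwd : ∀ z ∈ regularPoints f, ∀ x ∈ fiberClass c s f R z, b x = b z := by
    intro z hz x hx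
    obtain ⟨hxm, hfx, -⟩ := (hf.mem_fiberClass hz).mp hx
    rw [hb (⟨hxm, hfx ▸ hz.2⟩ : x ∈ regularPoints f), hb hz, classProd, classProd,
      hf.fiberClass_eq hR hz hx]
  refine ⟨d, t, b, hbt, htnd, htmem, fun z hz z' hz' => ⟨fun h => ?_, fun h => ?_⟩⟩
  · have hsub : (fiberClass c s f R z : Set ℂ) ⊆ {x | x ∈ ball (0 : ℂ) 1 ∧ b x = b z} :=
      fun x hx => ⟨((hf.mem_fiberClass hz).mp hx).1, hfwd z hz x hx⟩
    have hbz := hbt.mem_ball ht0 hz.1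
    -- The class lies in the fibre of `b` and has `card t` points, as the class of 0 does. The fibre
    -- has at most `card t` points, so the two coincide.
    have heq := eq_of_subset_of_ncard_le hsub (by
      rw [Set.ncard_coe_finset, hf.card_fiberClass_eq hs hR hz h0, ← hcard]
      exact hbt.ncard_fiber_le hbz) (hbt.finite_fiber hbz)
    have : z' ∈ (fiberClass c s f R z : Set ℂ) := heq ▸ ⟨hz', h.symm⟩
    have := (hf.mem_fiberClass hz).mp this
    exact ⟨this.2.1.symm, this.2.2⟩
  · exact (hfwd z hz z' ((hf.mem_fiberClass hz).mpr ⟨hz', h.1.symm, h.2⟩)).symm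

/-- An equivalence relation on the fibre over `0` preserved by continuation is given by the fibres
of a finite Blaschke product, through which `f` factors. -/
theorem exists_of_isZeroFiberRel (hf : IsBlaschkeWith c s f) (hf0 : f 0 = 0)
    (hsimple : ∀ a ∈ ball (0 : ℂ) 1, f a = 0 → deriv f a ≠ 0) {S : ℂ → ℂ → Prop}
    (hS : IsZeroFiberRel f S) :
    ∃ d t b, IsBlaschkeWith d t b ∧ t.Nodup ∧
      (∀ a, a ∈ t ↔ a ∈ ball (0 : ℂ) 1 ∧ f a = 0 ∧ S 0 a) ∧
      (∀ z ∈ ball (0 : ℂ) 1, ∀ z' ∈ ball (0 : ℂ) 1, b z = b z' → f z = f z') ∧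
      ∀ p ∈ ball (0 : ℂ) 1, ∀ q ∈ ball (0 : ℂ) 1, f p = 0 → f q = 0 → (b p = b q ↔ S p q) := by
  have h0s : (0 : ℂ) ∈ s := (hf.eq_zero_iff (by simp)).mp hf0
  have hs : s ≠ 0 := fun h => by simp [h] at h0s
  have hreg0 : (0 : ℂ) ∈ regularValues f :=
    ⟨by simp, fun ⟨z, hz, hd, hfz⟩ => hsimple z hz hfz hd⟩
  have hreg : ∀ p ∈ ball (0 : ℂ) 1, f p = 0 → p ∈ regularPoints f := fun p hp hfp =>
    ⟨hp, hfp.symm ▸ hreg0⟩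
  have h0 := hreg 0 (by simp) hf0
  obtain ⟨d, t, b, hb, htnd, ht, h⟩ :=
    hf.exists_of_isFiberRel hf0 hsimple (hf.isFiberRel_continuedRel hs hreg0 hS)
  have ht' : ∀ a, a ∈ t ↔ a ∈ ball (0 : ℂ) 1 ∧ f a = 0 ∧ S 0 a := fun a => by
    rw [ht]
    refine and_congr_right fun ha => and_congr_right fun hfa => ?_
    exact continuedRel_iff hS h0 (hreg a ha hfa) hf0 hfa
  have ht0 : t ≠ 0 := by
    intro h
    have := (ht' 0).mpr ⟨by simp, hf0, hS.refl 0 (by simp) hf0⟩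
    simp [h] at this
  refine ⟨d, t, b, hb, htnd, ht', fun z hz z' hz' hbz => ?_, fun p hp q hq hfp hfq => ?_⟩
  · refine hb.eq_of_eq_of_generic ht0 hf.differentiableOn.continuousOn
      (hf.finite_ball_diff_regularPoints hs) (fun x hx hxS x' hx' hbx => ?_) hz hz' hbz
    have hxr : x ∈ regularPoints f := by
      by_contra hxr
      exact hxS ⟨hx, hxr⟩
    exact ((h x hxr x' hx').mp hbx).1
  · rw [h p (hreg p hp hfp) q hq, hfp, hfq,
      continuedRel_iff hS (hreg p hp hfp) (hreg q hq hfq) hfp hfq]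
    simp

end IsBlaschkeWith
end

/-! ### Branches and their continuation along loops -/

noncomputable section

/-- A local left inverse of `f` at the common value recovers both functions. This is why branches
can be identified with their values. -/
theorem eventuallyEq_of_right_inverse {f u v : ℂ → ℂ} {w : ℂ} (hf : AnalyticAt ℂ f (u w))
    (hd : deriv f (u w) ≠ 0) (hu : ContinuousAt u w) (hv : ContinuousAt v w) (huv : u w = v w)
    (hfu : ∀ᶠ y in 𝓝 w, f (u y) = y) (hfv : ∀ᶠ y in 𝓝 w, f (v y) = y) : u =ᶠ[𝓝 w] v := by
  obtain ⟨g, -, -, -, hg⟩ := exists_local_inverse hf hd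
  have hg' := hg
  rw [huv] at hg'
  filter_upwards [hu.eventually hg, hv.eventually hg', hfu, hfv] with y h1 h2 h3 h4
  rw [← h1, ← h2, h3, h4]

/-- The Blaschke product `f` fixes `0` and its zeros are simple. -/
structure IsSimpleBlaschke (c : ℂ) (s : Multiset ℂ) (f : ℂ → ℂ) : Prop extends
    IsBlaschkeWith c s f where
  map_zero : f 0 = 0
  simple : ∀ a ∈ ball (0 : ℂ) 1, f a = 0 → deriv f a ≠ 0

theorem InvBranch.exists_rep {f : ℂ → ℂ} (g : InvBranch f) :
    ∃ u : ℂ → ℂ, AnalyticAt ℂ u 0 ∧ u 0 = g.value ∧ (∀ᶠ w in 𝓝 (0 : ℂ), f (u w) = w) ∧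
      g.1 = (u : Germ (𝓝 (0 : ℂ)) ℂ) := by
  obtain ⟨_, u, hu, hu0, hfu, rfl⟩ := g
  exact ⟨u, hu, rfl, hfu, rfl⟩

theorem InvBranch.value_mem {f : ℂ → ℂ} (g : InvBranch f) : g.value ∈ ball (0 : ℂ) 1 := by
  obtain ⟨_, u, hu, hu0, hfu, rfl⟩ := g
  exact hu0

theorem InvBranch.apply_value {f : ℂ → ℂ} (g : InvBranch f) : f g.value = 0 := by
  obtain ⟨u, -, hu0, hfu, -⟩ := g.exists_rep
  rw [← hu0]
  exact hfu.self_of_nhds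

namespace IsSimpleBlaschke

variable {c : ℂ} {s : Multiset ℂ} {f : ℂ → ℂ}

theorem zeros_ne_zero (hf : IsSimpleBlaschke c s f) : s ≠ 0 := fun h => by
  have := (hf.eq_zero_iff (z := 0) (by simp)).mp hf.map_zero
  simp [h] at this

theorem value_injective (hf : IsSimpleBlaschke c s f) :
    Function.Injective (InvBranch.value (I := f)) := by
  intro g h hgh
  obtain ⟨u, hu, hu0, hfu, hgu⟩ := g.exists_rep
  obtain ⟨v, hv, hv0, hfv, hhv⟩ := h.exists_rep
  refine Subtype.ext ?_
  rw [hgu, hhv, Germ.coe_eq]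
  exact eventuallyEq_of_right_inverse (by rw [hu0]; exact hf.analyticAt g.value_mem)
    (by rw [hu0]; exact hf.simple _ g.value_mem g.apply_value) hu.continuousAt hv.continuousAt
    (by rw [hu0, hv0, hgh]) hfu hfv

theorem exists_branch (hf : IsSimpleBlaschke c s f) {a : ℂ} (ha : a ∈ ball (0 : ℂ) 1)
    (hfa : f a = 0) : ∃ g : InvBranch f, g.value = a := by
  obtain ⟨u, hu, hua, hfu, -⟩ := exists_local_inverse (hf.analyticAt ha) (hf.simple a ha hfa)
  rw [hfa] at hu hua hfu
  exact ⟨⟨u, u, hu, hua.symm ▸ ha, hfu, rfl⟩, hua⟩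

theorem image_value (hf : IsSimpleBlaschke c s f) (T : Set (InvBranch f)) {p : ℂ → Prop}
    (hT : ∀ h, h ∈ T ↔ p h.value) :
    InvBranch.value '' T = {a | (a ∈ ball (0 : ℂ) 1 ∧ f a = 0) ∧ p a} := by
  ext a
  constructor
  · rintro ⟨g, hg, rfl⟩
    exact ⟨⟨g.value_mem, g.apply_value⟩, (hT g).mp hg⟩
  · rintro ⟨⟨ha, hfa⟩, hp⟩
    obtain ⟨g, rfl⟩ := hf.exists_branch ha hfa
    exact ⟨g, (hT g).mpr hp, rfl⟩

theorem range_value (hf : IsSimpleBlaschke c s f) :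
    range (InvBranch.value (I := f)) = {a | a ∈ ball (0 : ℂ) 1 ∧ f a = 0} := by
  rw [← image_univ, hf.image_value univ (p := fun _ => True) (by simp)]
  simp

theorem finite_branches (hf : IsSimpleBlaschke c s f) : Finite (InvBranch f) := by
  rw [← finite_range_iff hf.value_injective, hf.range_value]
  exact hf.finite_fiber (by simp)

theorem card_branches (hf : IsSimpleBlaschke c s f) :
    Nat.card (InvBranch f) = Multiset.card s := by
  rw [← Nat.card_range_of_injective hf.value_injective, hf.range_value, Nat.card_coe_set_eq]
  exact hf.ncard_fiber (by simp) hf.simple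

/-- A lift of a loop gives the analytic continuation of a branch. -/
theorem continuesAlong_of_lift (hf : IsSimpleBlaschke c s f) {γ : Path (0 : ℂ) 0}
    (hγ : ∀ t, γ t ∈ regularValues f) {L : unitInterval → ℂ} (hL : Continuous L)
    (hLm : ∀ t, L t ∈ ball (0 : ℂ) 1) (hLγ : ∀ t, f (L t) = γ t) {g h : InvBranch f}
    (hg : g.value = L 0) (hh : h.value = L 1) : ContinuesAlong γ g.1 h.1 := by
  have hd : ∀ t, deriv f (L t) ≠ 0 := fun t =>
    deriv_ne_zero_of_mem_regularValues (hLm t) (by rw [hLγ]; exact hγ t)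
  -- The chain of germs consists of the local inverses at the points of the lift; neighbouring ones
  -- agree because they invert `f` and share a value.
  choose F hF hFL hfF hFf using fun t => exists_local_inverse (hf.analyticAt (hLm t)) (hd t)
  simp only [hLγ] at hF hFL hfF
  have hend : ∀ (k : InvBranch f) (t : unitInterval), γ t = 0 → k.value = L t →
      k.1 = (F t : Germ (𝓝 (0 : ℂ)) ℂ) := by
    intro k t ht hk
    obtain ⟨u, hu, hu0, hfu, hku⟩ := k.exists_rep
    have h1 := hF t
    have h2 := hFL t
    have h3 := hfF t
    rw [ht] at h1 h2 h3
    rw [hku, Germ.coe_eq]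
    exact eventuallyEq_of_right_inverse (by rw [hu0]; exact hf.analyticAt k.value_mem)
      (by rw [hu0]; exact hf.simple _ k.value_mem k.apply_value) hu.continuousAt h1.continuousAt
      (by rw [hu0, hk, h2]) hfu h3
  refine ⟨F, hF, fun t => ?_, hend g 0 γ.source hg, hend h 1 γ.target hh⟩
  have hγt : ContinuousAt γ t := γ.continuous.continuousAt
  filter_upwards [hγt.eventually (hF t).eventually_analyticAt,
    hL.continuousAt.eventually (hFf t), hγt.eventually (hfF t).eventually_nhds]
    with r h1 h2 h3
  rw [hLγ] at h2
  exact eventuallyEq_of_right_inverse (by rw [hFL]; exact hf.analyticAt (hLm r))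
    (by rw [hFL]; exact hd r) (hF r).continuousAt h1.continuousAt (by rw [hFL, h2]) (hfF r) h3

/-- A path in the pairs of points in the same fibre gives a permutation of the branches. -/
theorem exists_isLoopPerm (hf : IsSimpleBlaschke c s f) {p q p' q' : ℂ} (hp : f p = 0)
    (hp' : f p' = 0) (h : JoinedIn (fiberPairs f) (p, q) (p', q')) :
    ∃ σ, IsLoopPerm f σ ∧ (∀ g, g.value = p → (σ g).value = p') ∧
      ∀ g, g.value = q → (σ g).value = q' := by
  obtain ⟨Γ, hΓ⟩ := h
  have hΓ1 : Continuous fun t => (Γ t).1 := continuous_fst.comp Γ.continuous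
  have hΓ2 : Continuous fun t => (Γ t).2 := continuous_snd.comp Γ.continuous
  -- Both coordinates of the path of pairs lift this one loop, so by uniqueness of lifts a single
  -- permutation moves both points as required.
  let γ : Path (0 : ℂ) 0 :=
    { toFun := fun t => f (Γ t).1
      continuous_toFun := hf.differentiableOn.continuousOn.comp_continuous hΓ1
        fun t => (hΓ t).1.1
      source' := by simp [hp]
      target' := by simp [hp'] }
  have hγ : ∀ t, γ t ∈ regularValues f := fun t => (hΓ t).1.2
  have hlift : ∀ g : InvBranch f, ∃ L : unitInterval → ℂ, Continuous L ∧ L 0 = g.value ∧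
      ∀ t, L t ∈ ball (0 : ℂ) 1 ∧ f (L t) = γ t := fun g =>
    hf.exists_lift hf.zeros_ne_zero γ.continuous hγ g.value_mem
      (g.apply_value.trans γ.source.symm)
  choose L hL hL0 hLm using hlift
  have hreg : ∀ g t, L g t ∈ regularPoints f := fun g t =>
    ⟨(hLm g t).1, by rw [(hLm g t).2]; exact hγ t⟩
  have huniq : ∀ g (K : unitInterval → ℂ), Continuous K → (∀ t, K t ∈ regularPoints f) →
      (∀ t, f (K t) = γ t) → ∀ t₀, L g t₀ = K t₀ → L g = K := fun g K hK hKr hKγ t₀ h0 =>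
    hf.lift_unique hf.zeros_ne_zero (hL g) hK (hreg g) hKr
      (fun t => (hLm g t).2.trans (hKγ t).symm) h0
  choose τ hτ using fun g => hf.exists_branch (hLm g 1).1 ((hLm g 1).2.trans γ.target)
  -- Lifts with the same endpoint coincide, hence have the same starting point; finiteness then
  -- gives bijectivity.
  have hinj : Function.Injective τ := by
    intro g h hgh
    have h1 : L g 1 = L h 1 := by rw [← hτ, ← hτ, hgh]
    have h2 := huniq g (L h) (hL h) (hreg h) (fun t => (hLm h t).2) 1 h1
    exact hf.value_injective (by rw [← hL0, ← hL0, h2])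
  have := hf.finite_branches
  have hγ2 : ∀ t, f (Γ t).2 = γ t := fun t => (hΓ t).2.2.symm
  refine ⟨Equiv.ofBijective τ (Finite.injective_iff_bijective.mp hinj),
    ⟨γ, hγ, fun g => hf.continuesAlong_of_lift hγ (hL g) (fun t => (hLm g t).1)
      (fun t => (hLm g t).2) (hL0 g).symm (hτ g)⟩, fun g hg => ?_, fun g hg => ?_⟩
  · change (τ g).value = p'
    have h0 : L g 0 = (Γ 0).1 := by rw [hL0, hg, Γ.source]
    rw [hτ, huniq g _ hΓ1 (fun t => (hΓ t).1) (fun t => rfl) 0 h0]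
    simp
  · change (τ g).value = q'
    have h0 : L g 0 = (Γ 0).2 := by rw [hL0, hg, Γ.source]
    rw [hτ, huniq g _ hΓ2 (fun t => (hΓ t).2.1) hγ2 0 h0]
    simp

/-- The analytic continuations of a branch along a loop which avoids the critical values are
again local inverses. -/
theorem continuation_isRightInverse (hf : IsSimpleBlaschke c s f) {γ : Path (0 : ℂ) 0}
    (hγ : ∀ t, γ t ∈ regularValues f) {F : unitInterval → ℂ → ℂ}
    (hF : ∀ t, AnalyticAt ℂ (F t) (γ t)) (hFF : ∀ t, ∀ᶠ r in 𝓝 t, F r =ᶠ[𝓝 (γ r)] F t)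
    {g : InvBranch f} (hg : g.1 = (F 0 : Germ (𝓝 (0 : ℂ)) ℂ)) (t : unitInterval) :
    F t (γ t) ∈ ball (0 : ℂ) 1 ∧ ∀ᶠ w in 𝓝 (γ t), f (F t w) = w := by
  refine isPreconnected_univ.of_locally_iff
    (p := fun t => F t (γ t) ∈ ball (0 : ℂ) 1 ∧ ∀ᶠ w in 𝓝 (γ t), f (F t w) = w)
    (fun t _ => ?_) (mem_univ (0 : unitInterval)) (mem_univ t) ?_
  · rw [nhdsWithin_univ]
    obtain ⟨ε, ι, σ, -, hσ⟩ := hf.exists_isLocalSections hf.zeros_ne_zero (hγ t)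
    obtain ⟨δ, hδ, hFδ⟩ := Metric.eventually_nhds_iff_ball.mp
      ((hF t).eventually_analyticAt.and (ball_mem_nhds (γ t) hσ.pos))
    have hγt : ContinuousAt γ t := γ.continuous.continuousAt
    filter_upwards [hFF t, hγt.eventually (ball_mem_nhds (γ t) hδ)] with r hr hrδ
    -- If `F t` is a local inverse near one point of the small disk, it equals a local section near
    -- that point, hence on the whole disk by the identity theorem.
    have key : ∀ x ∈ ball (γ t) δ, ∀ y ∈ ball (γ t) δ,
        (F t x ∈ ball (0 : ℂ) 1 ∧ ∀ᶠ w in 𝓝 x, f (F t w) = w) →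
        (F t y ∈ ball (0 : ℂ) 1 ∧ ∀ᶠ w in 𝓝 y, f (F t w) = w) := by
      rintro x hx y hy ⟨h1, h2⟩
      have hfx := h2.self_of_nhds
      obtain ⟨i, hi⟩ := hσ.exists_eq x (hFδ x hx).2 _ h1 hfx
      have hev : F t =ᶠ[𝓝 x] σ i := eventuallyEq_of_right_inverse (hf.analyticAt h1)
        (deriv_ne_zero_of_mem_regularValues h1 (by rw [hfx]; exact hσ.ball_subset (hFδ x hx).2))
        (hFδ x hx).1.continuousAt (hσ.analyticAt i x (hFδ x hx).2).continuousAt hi.symm h2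
        (by filter_upwards [isOpen_ball.mem_nhds hx] with w hw
            using hσ.right_inv i w (hFδ w hw).2)
      have heq : EqOn (F t) (σ i) (ball (γ t) δ) :=
        AnalyticOnNhd.eqOn_of_preconnected_of_eventuallyEq (fun w hw => (hFδ w hw).1)
          (fun w hw => hσ.analyticAt i w (hFδ w hw).2) (convex_ball _ _).isPreconnected hx hev
      refine ⟨heq hy ▸ hσ.mem i y (hFδ y hy).2, ?_⟩
      filter_upwards [isOpen_ball.mem_nhds hy] with w hw
      rw [heq hw, hσ.right_inv i w (hFδ w hw).2]
    have hrt : (F r (γ r) ∈ ball (0 : ℂ) 1 ∧ ∀ᶠ w in 𝓝 (γ r), f (F r w) = w) ↔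
        (F t (γ r) ∈ ball (0 : ℂ) 1 ∧ ∀ᶠ w in 𝓝 (γ r), f (F t w) = w) := by
      rw [hr.self_of_nhds]
      refine and_congr_right fun _ => eventually_congr ?_
      filter_upwards [hr] with w hw
      rw [hw]
    rw [hrt]
    exact ⟨key _ hrδ _ (mem_ball_self hδ), key _ (mem_ball_self hδ) _ hrδ⟩
  · obtain ⟨u, hu, hu0, hfu, hgu⟩ := g.exists_rep
    have hev : u =ᶠ[𝓝 0] F 0 := Germ.coe_eq.mp (hgu.symm.trans hg)
    rw [γ.source, ← hev.self_of_nhds, hu0]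
    refine ⟨g.value_mem, ?_⟩
    filter_upwards [hfu, hev] with w h1 h2
    rw [← h2, h1]

end IsSimpleBlaschke

/-- Two analytic continuations along the same path agree at the start iff they agree at the end. -/
theorem continuation_eventuallyEq_iff {γ : Path (0 : ℂ) 0} {F G : unitInterval → ℂ → ℂ}
    (hF : ∀ t, AnalyticAt ℂ (F t) (γ t)) (hFF : ∀ t, ∀ᶠ r in 𝓝 t, F r =ᶠ[𝓝 (γ r)] F t)
    (hG : ∀ t, AnalyticAt ℂ (G t) (γ t)) (hGG : ∀ t, ∀ᶠ r in 𝓝 t, G r =ᶠ[𝓝 (γ r)] G t) :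
    F 0 =ᶠ[𝓝 0] G 0 ↔ F 1 =ᶠ[𝓝 0] G 1 := by
  have hloc : ∀ t, ∀ᶠ r in 𝓝 t, (F r =ᶠ[𝓝 (γ r)] G r ↔ F t =ᶠ[𝓝 (γ t)] G t) := by
    intro t
    obtain ⟨δ, hδ, h⟩ := Metric.eventually_nhds_iff_ball.mp
      ((hF t).eventually_analyticAt.and (hG t).eventually_analyticAt)
    have hγt : ContinuousAt γ t := γ.continuous.continuousAt
    filter_upwards [hFF t, hGG t, hγt.eventually (ball_mem_nhds (γ t) hδ)] with r h1 h2 hr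
    have key : ∀ x ∈ ball (γ t) δ, ∀ y ∈ ball (γ t) δ, F t =ᶠ[𝓝 x] G t → F t =ᶠ[𝓝 y] G t := by
      intro x hx y hy hxy
      have heq : EqOn (F t) (G t) (ball (γ t) δ) :=
        AnalyticOnNhd.eqOn_of_preconnected_of_eventuallyEq (fun w hw => (h w hw).1)
          (fun w hw => (h w hw).2) (convex_ball _ _).isPreconnected hx hxy
      exact heq.eventuallyEq_of_mem (isOpen_ball.mem_nhds hy)
    exact ⟨fun h3 => key _ hr _ (mem_ball_self hδ) (h1.symm.trans (h3.trans h2)),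
      fun h3 => h1.trans ((key _ (mem_ball_self hδ) _ hr h3).trans h2.symm)⟩
  have hall : ∀ t r : unitInterval, F t =ᶠ[𝓝 (γ t)] G t → F r =ᶠ[𝓝 (γ r)] G r := fun t r h =>
    isPreconnected_univ.of_locally_iff (p := fun t => F t =ᶠ[𝓝 (γ t)] G t)
      (fun t _ => by rw [nhdsWithin_univ]; exact hloc t) (mem_univ t) (mem_univ r) h
  have h01 := hall 0 1
  have h10 := hall 1 0
  rw [γ.source, γ.target] at h01 h10
  exact ⟨h01, h10⟩
end

/-! ### Partitions and factorizations -/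

noncomputable section

open scoped ComplexConjugate

@[simp] theorem blaschkeFactor_zero (z : ℂ) : blaschkeFactor 0 z = z := by simp [blaschkeFactor]

theorem deriv_blaschkeProd_zero_ne_zero {t : Multiset ℂ} (ht : ∀ a ∈ t, a ∈ ball (0 : ℂ) 1)
    (hnd : t.Nodup) (h0 : (0 : ℂ) ∈ t) : deriv (blaschkeProd t) 0 ≠ 0 := by
  obtain ⟨t, rfl⟩ := Multiset.exists_cons_of_mem h0
  have ht' : ∀ a ∈ t, a ∈ ball (0 : ℂ) 1 := fun a ha => ht a (by simp [ha])
  have h1 : blaschkeProd (0 ::ₘ t) = fun z => z * blaschkeProd t z := by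
    funext z
    simp
  have h2 : HasDerivAt (blaschkeProd t) (deriv (blaschkeProd t) 0) 0 :=
    ((differentiableOn_blaschkeProd ht').differentiableAt (ball_mem_nhds 0 one_pos)).hasDerivAt
  have h3 := ((hasDerivAt_id (0 : ℂ)).mul h2).deriv
  rw [h1]
  change deriv (fun z => z * blaschkeProd t z) 0 = _ at h3
  rw [h3]
  simpa using mt (blaschkeProd_eq_zero_iff ht' (z := 0) (by simp)).mp (Multiset.nodup_cons.mp hnd).1

theorem blaschkeProd_eq_finprod {t : Multiset ℂ} (hnd : t.Nodup) (z : ℂ) :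
    ∏ᶠ a ∈ {a | a ∈ t}, blaschkeFactor a z = blaschkeProd t z := by
  classical
  have h : {a | a ∈ t} = (t.toFinset : Set ℂ) := by ext a; simp
  rw [h, finprod_mem_coe_finset, blaschkeProd, Finset.prod, Multiset.toFinset_val, hnd.dedup]

namespace IsSimpleBlaschke

variable {c : ℂ} {s : Multiset ℂ} {f : ℂ → ℂ}

theorem blaschkeOf_spec (hf : IsSimpleBlaschke c s f) {P : Set (Set (InvBranch f))}
    {t : Multiset ℂ} (hnd : t.Nodup) (h0 : (0 : ℂ) ∈ t)
    (hP : InvBranch.value '' zeroBlock P = {a | a ∈ t}) :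
    (∃ e, IsBlaschkeWith e t (blaschkeOf P)) ∧ VanishesWithPosDeriv (blaschkeOf P) := by
  have hmonic : monicBlaschkeOf P = blaschkeProd t := by
    funext z
    rw [← blaschkeProd_eq_finprod hnd, ← hP, finprod_mem_image hf.value_injective.injOn]
    rfl
  have ht : ∀ a ∈ t, a ∈ ball (0 : ℂ) 1 := by
    intro a ha
    obtain ⟨g, -, rfl⟩ : a ∈ InvBranch.value '' zeroBlock P := hP ▸ ha
    exact g.value_mem
  set m := deriv (blaschkeProd t) 0 with hm
  have hm0 : m ≠ 0 := deriv_blaschkeProd_zero_ne_zero ht hnd h0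
  have hmn : (‖m‖ : ℂ) ≠ 0 := by exact_mod_cast norm_ne_zero_iff.mpr hm0
  have heq : blaschkeOf P = fun z => conj m / ‖m‖ * blaschkeProd t z := by
    funext z
    rw [blaschkeOf, hmonic]
  -- The normalizing constant turns the derivative into `conj m * m / ‖m‖`.
  have hderiv : deriv (blaschkeOf P) 0 = ‖m‖ := by
    rw [heq, deriv_const_mul_field, ← hm, div_mul_eq_mul_div, mul_comm, Complex.mul_conj,
      Complex.normSq_eq_norm_sq, div_eq_iff hmn]
    push_cast
    ring
  refine ⟨⟨conj m / ‖m‖, ?_, ht, fun z _ => by rw [heq]⟩, ?_, ?_, ?_⟩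
  · rw [norm_div, RCLike.norm_conj, Complex.norm_real, norm_norm, div_self]
    exact norm_ne_zero_iff.mpr hm0
  · rw [heq]
    simp [(blaschkeProd_eq_zero_iff ht (z := 0) (by simp)).mpr h0]
  · rw [hderiv, Complex.ofReal_re]
    exact norm_pos_iff.mpr hm0
  · rw [hderiv, Complex.ofReal_im]

section Factorization

variable {cJ cb : ℂ} {sJ sb : Multiset ℂ} {J b : ℂ → ℂ}

theorem deriv_mul_ne_zero (hf : IsSimpleBlaschke c s f) (hJ : IsBlaschkeWith cJ sJ J)
    (hb : IsBlaschkeWith cb sb b) (hsb : sb ≠ 0) (hcomp : EqOn f (J ∘ b) (ball 0 1)) {a : ℂ}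
    (ha : a ∈ ball (0 : ℂ) 1) (hfa : f a = 0) : deriv J (b a) * deriv b a ≠ 0 := by
  have h1 := (hJ.analyticAt (hb.mem_ball hsb ha)).differentiableAt
  have h2 := (hb.analyticAt ha).differentiableAt
  rw [← deriv_comp a h1 h2, ← (hcomp.eventuallyEq_of_mem (isOpen_ball.mem_nhds ha)).deriv_eq]
  exact hf.simple a ha hfa

/-- Composed with `b`, a branch becomes a right inverse of `J` near 0, at a point where the chain
rule gives `J` nonzero derivative; such a germ is determined by its value. -/
theorem comp_eq_comp_iff (hf : IsSimpleBlaschke c s f) (hJ : IsBlaschkeWith cJ sJ J)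
    (hb : IsBlaschkeWith cb sb b) (hsb : sb ≠ 0) (hcomp : EqOn f (J ∘ b) (ball 0 1))
    (g h : InvBranch f) : g.comp b = h.comp b ↔ b g.value = b h.value := by
  obtain ⟨u, hu, hu0, hfu, hgu⟩ := g.exists_rep
  obtain ⟨v, hv, hv0, hfv, hhv⟩ := h.exists_rep
  have hJinv : ∀ {k : InvBranch f} {w : ℂ → ℂ}, AnalyticAt ℂ w 0 → w 0 = k.value →
      (∀ᶠ y in 𝓝 (0 : ℂ), f (w y) = y) → ∀ᶠ y in 𝓝 (0 : ℂ), J ((b ∘ w) y) = y := by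
    intro k w hw hw0 hfw
    filter_upwards [hfw, hw.continuousAt.eventually_mem
      (by rw [hw0]; exact isOpen_ball.mem_nhds k.value_mem)] with y h1 h2
    exact (hcomp h2).symm.trans h1
  rw [InvBranch.comp, InvBranch.comp, hgu, hhv, Germ.map_coe, Germ.map_coe, Germ.coe_eq,
    ← hu0, ← hv0]
  constructor
  · exact fun h => h.self_of_nhds
  · intro huv
    have hb1 : AnalyticAt ℂ b (u 0) := by rw [hu0]; exact hb.analyticAt g.value_mem
    have hb2 : AnalyticAt ℂ b (v 0) := by rw [hv0]; exact hb.analyticAt h.value_mem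
    refine eventuallyEq_of_right_inverse (f := J) (u := b ∘ u) (v := b ∘ v) ?_ ?_
      (hb1.continuousAt.comp hu.continuousAt) (hb2.continuousAt.comp hv.continuousAt) huv
      (hJinv hu hu0 hfu) (hJinv hv hv0 hfv)
    · rw [Function.comp_apply, hu0]
      exact hJ.analyticAt (hb.mem_ball hsb g.value_mem)
    · rw [Function.comp_apply, hu0]
      exact left_ne_zero_of_mul (hf.deriv_mul_ne_zero hJ hb hsb hcomp g.value_mem g.apply_value)

/-- For one loop this is the permanence of identities: composing the chains for `g` and `h` with `b`
gives continuations along the same loop. The equivalence passes to products and inverses. -/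
theorem comp_eq_comp_iff_of_mem_branchGroup (hf : IsSimpleBlaschke c s f)
    (hb : IsBlaschkeWith cb sb b) {σ : Equiv.Perm (InvBranch f)} (hσ : σ ∈ branchGroup f)
    (g h : InvBranch f) : (σ g).comp b = (σ h).comp b ↔ g.comp b = h.comp b := by
  induction hσ using Subgroup.closure_induction generalizing g h with
  | one => rfl
  | mul σ τ _ _ h1 h2 => rw [Equiv.Perm.mul_apply, Equiv.Perm.mul_apply, h1, h2]
  | inv σ _ h1 =>
    rw [← h1]
    simp
  | mem σ hσ =>
    obtain ⟨γ, hγ, hcont⟩ := hσ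
    obtain ⟨F, hF, hFF, hgF, hgF'⟩ := hcont g
    obtain ⟨G, hG, hGG, hhG, hhG'⟩ := hcont h
    have hFm := fun t => (hf.continuation_isRightInverse hγ hF hFF hgF t).1
    have hGm := fun t => (hf.continuation_isRightInverse hγ hG hGG hhG t).1
    have key := continuation_eventuallyEq_iff (γ := γ) (F := fun t => b ∘ F t)
      (G := fun t => b ∘ G t) (fun t => (hb.analyticAt (hFm t)).comp (hF t))
      (fun t => (hFF t).mono fun r hr => hr.fun_comp b)
      (fun t => (hb.analyticAt (hGm t)).comp (hG t))
      (fun t => (hGG t).mono fun r hr => hr.fun_comp b)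
    rw [InvBranch.comp, InvBranch.comp, InvBranch.comp, InvBranch.comp, hgF, hgF', hhG, hhG',
      Germ.map_coe, Germ.map_coe, Germ.map_coe, Germ.map_coe, Germ.coe_eq, Germ.coe_eq, key]

theorem isRespectedPartition_partitionOf (hf : IsSimpleBlaschke c s f)
    (hb : IsBlaschkeWith cb sb b) : IsRespectedPartition f (partitionOf f b) := by
  constructor
  · have := Setoid.isPartition_classes (Setoid.ker fun g : InvBranch f => g.comp b)
    exact this
  · rintro σ hσ _ ⟨g, rfl⟩
    refine ⟨σ g, ?_⟩
    ext h
    rw [Equiv.image_eq_preimage_symm]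
    change (σ.symm h).comp b = g.comp b ↔ h.comp b = (σ g).comp b
    rw [← hf.comp_eq_comp_iff_of_mem_branchGroup hb hσ, Equiv.apply_symm_apply]

/-- The values of a block form a full fibre of `b`, which consists of zeros of `f`. By the chain
rule `b` has no critical points there, so the fibre has as many points as `b` has zeros. -/
theorem hasPartitionOrder_partitionOf (hf : IsSimpleBlaschke c s f) (hJ : IsBlaschkeWith cJ sJ J)
    (hb : IsBlaschkeWith cb sb b) (hsb : sb ≠ 0) (hcomp : EqOn f (J ∘ b) (ball 0 1)) :
    HasPartitionOrder (partitionOf f b) (Multiset.card sb) := by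
  rintro _ ⟨g, rfl⟩
  have := hf.finite_branches
  refine ⟨toFinite _, ?_⟩
  have hfib : ∀ z ∈ ball (0 : ℂ) 1, b z = b g.value → f z = 0 := by
    intro z hz hbz
    rw [hcomp hz, Function.comp_apply, hbz, ← Function.comp_apply (f := J), ← hcomp g.value_mem,
      g.apply_value]
  rw [← Set.ncard_image_of_injective _ hf.value_injective,
    hf.image_value {h | h.comp b = g.comp b} (p := fun a => b a = b g.value)
      (fun h => hf.comp_eq_comp_iff hJ hb hsb hcomp h g),
    ← hb.ncard_fiber (hb.mem_ball hsb g.value_mem) fun z hz hbz =>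
      right_ne_zero_of_mul (hf.deriv_mul_ne_zero hJ hb hsb hcomp hz (hfib z hz hbz))]
  congr 1
  ext z
  exact ⟨fun h => ⟨h.1.1, h.2⟩, fun h => ⟨⟨h.1, hfib z h.1 h.2⟩, h.2⟩⟩

theorem mem_zeroBlock_partitionOf (hf : IsSimpleBlaschke c s f) (hJ : IsBlaschkeWith cJ sJ J)
    (hb : IsBlaschkeWith cb sb b) (hsb : sb ≠ 0) (hcomp : EqOn f (J ∘ b) (ball 0 1))
    (h : InvBranch f) : h ∈ zeroBlock (partitionOf f b) ↔ b h.value = b 0 := by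
  constructor
  · rintro ⟨_, ⟨k, rfl⟩, hh, g, hg, hg0⟩
    rw [← hg0, ← hf.comp_eq_comp_iff hJ hb hsb hcomp]
    exact Eq.trans hh hg.symm
  · intro hh
    obtain ⟨g, hg⟩ := hf.exists_branch (a := 0) (by simp) hf.map_zero
    exact ⟨_, ⟨g, rfl⟩, (hf.comp_eq_comp_iff hJ hb hsb hcomp h g).mpr (by rw [hg, hh]), g, rfl, hg⟩

/-- A right factor of `f` is, up to an automorphism of the disk, the Blaschke product given by its
partition. -/
theorem exists_eq_of_factorization (hf : IsSimpleBlaschke c s f) (hJ : IsBlaschkeWith cJ sJ J)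
    (hb : IsBlaschkeWith cb sb b) (hsb : sb ≠ 0) (hcomp : EqOn f (J ∘ b) (ball 0 1)) :
    (∃ d, ‖d‖ = 1 ∧ ∀ z ∈ ball (0 : ℂ) 1,
      blaschkeFactor (b 0) (b z) = d * blaschkeOf (partitionOf f b) z) ∧
    VanishesWithPosDeriv (blaschkeOf (partitionOf f b)) := by
  have hb0 : b 0 ∈ ball (0 : ℂ) 1 := hb.mem_ball hsb (by simp)
  have hbm : ∀ z ∈ ball (0 : ℂ) 1, b z ∈ ball (0 : ℂ) 1 := fun z hz => hb.mem_ball hsb hz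
  have hJ0 : J (b 0) = 0 := by
    rw [← Function.comp_apply (f := J), ← hcomp (by simp), hf.map_zero]
  -- Since `J` vanishes at `b 0`, Schwarz-Pick for `J` bounds `‖f z‖` by the modulus of this
  -- function, so squeezing applies.
  obtain ⟨d, t, hts, ht⟩ := exists_isBlaschkeWith_of_blaschkeProd_le
    (f := fun z => blaschkeFactor (b 0) (b z)) hf.zeros_mem
    ((differentiableOn_blaschkeFactor hb0).comp hb.differentiableOn hbm)
    (fun z hz => (norm_blaschkeFactor_lt_one hb0 (hbm z hz)).le)
    (fun z hz => by
      rw [← hf.norm_eq hz, hcomp hz]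
      exact norm_le_norm_blaschkeFactor hJ.differentiableOn (fun x hx => hJ.norm_le_one hx) hb0
        hJ0 (hbm z hz))
  have htmem : ∀ a ∈ ball (0 : ℂ) 1, (a ∈ t ↔ b a = b 0) := fun a ha => by
    rw [← ht.eq_zero_iff ha, blaschkeFactor_eq_zero_iff hb0 (hbm a ha)]
  have hval : InvBranch.value '' zeroBlock (partitionOf f b) = {a | a ∈ t} := by
    rw [hf.image_value _ (p := fun a => b a = b 0)
      (hf.mem_zeroBlock_partitionOf hJ hb hsb hcomp)]
    ext a
    constructor
    · rintro ⟨⟨ha, -⟩, h⟩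
      exact (htmem a ha).mpr h
    · intro hat
      have has := Multiset.mem_of_le hts hat
      have ha := hf.zeros_mem a has
      exact ⟨⟨ha, (hf.eq_zero_iff ha).mpr has⟩, (htmem a ha).mp hat⟩
  obtain ⟨⟨e, he⟩, hnorm⟩ := hf.blaschkeOf_spec
    (Multiset.nodup_of_le hts (hf.nodup_zeros hf.simple)) ((htmem 0 (by simp)).mpr rfl) hval
  have he0 : e ≠ 0 := norm_ne_zero_iff.mp (by rw [he.norm_const]; norm_num)
  refine ⟨⟨d / e, by rw [norm_div, ht.norm_const, he.norm_const, div_one], fun z hz => ?_⟩, hnorm⟩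
  rw [ht.eq_on z hz, he.eq_on z hz, ← mul_assoc, div_mul_cancel₀ d he0]

theorem exists_automorphism (hf : IsSimpleBlaschke c s f) (hJ : IsBlaschkeWith cJ sJ J)
    (hb : IsBlaschkeWith cb sb b) (hsb : sb ≠ 0) (hcomp : EqOn f (J ∘ b) (ball 0 1)) :
    ∃ φ : ℂ → ℂ, IsFiniteBlaschke 1 φ ∧
      EqOn b (φ ∘ blaschkeOf (partitionOf f b)) (ball (0 : ℂ) 1) := by
  obtain ⟨⟨d, hd, hdb⟩, -⟩ := hf.exists_eq_of_factorization hJ hb hsb hcomp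
  have hb0 : b 0 ∈ ball (0 : ℂ) 1 := hb.mem_ball hsb (by simp)
  have hd0 : d ≠ 0 := norm_ne_zero_iff.mp (by rw [hd]; norm_num)
  have hdd : conj d * d = 1 := by
    rw [mul_comm, Complex.mul_conj, Complex.normSq_eq_norm_sq, hd]
    norm_num
  -- The inverse automorphism after the rotation by `d`. Its zero solves `d * z = -b 0`, and `conj
  -- d` is the inverse of `d`.
  refine ⟨fun z => blaschkeFactor (-b 0) (d * z), isFiniteBlaschke_iff.mpr ⟨one_pos, d,
    {-(conj d * b 0)}, by simp, hd, ?_, fun z _ => ?_⟩, fun z hz => ?_⟩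
  · rw [mem_ball_zero_iff] at hb0
    simpa [hd] using hb0
  · have h1 : d * (z - -(conj d * b 0)) = d * z - -b 0 := by
      linear_combination b 0 * hdd
    have h2 : conj (-(conj d * b 0)) * z = conj (-b 0) * (d * z) := by
      rw [map_neg, map_mul, Complex.conj_conj, map_neg]
      ring
    rw [blaschkeProd, Multiset.map_singleton, Multiset.prod_singleton, blaschkeFactor,
      blaschkeFactor, h2, ← h1, mul_div_assoc]
  · rw [Function.comp_apply, ← hdb z hz, blaschkeFactor_neg_comp hb0 (hb.mem_ball hsb hz)]

theorem blaschkeOf_partitionOf_eq (hf : IsSimpleBlaschke c s f) (hJ : IsBlaschkeWith cJ sJ J)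
    (hb : IsBlaschkeWith cb sb b) (hsb : sb ≠ 0) (hcomp : EqOn f (J ∘ b) (ball 0 1))
    (hbn : VanishesWithPosDeriv b) :
    EqOn (blaschkeOf (partitionOf f b)) b (ball (0 : ℂ) 1) := by
  obtain ⟨⟨d, hd, hdb⟩, -, hre, him⟩ := hf.exists_eq_of_factorization hJ hb hsb hcomp
  obtain ⟨hb0, hre', him'⟩ := hbn
  have heq : EqOn b (fun z => d * blaschkeOf (partitionOf f b) z) (ball (0 : ℂ) 1) :=
    fun z hz => by simpa [hb0] using hdb z hz
  have hderiv := (heq.eventuallyEq_of_mem (ball_mem_nhds 0 one_pos)).deriv_eq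
  rw [deriv_const_mul_field] at hderiv
  set x := deriv b 0 with hx
  set y := deriv (blaschkeOf (partitionOf f b)) 0 with hy
  have hxr : x = (x.re : ℂ) := Complex.ext rfl (by simpa using him')
  have hyr : y = (y.re : ℂ) := Complex.ext rfl (by simpa using him)
  have hxy : x.re = y.re := by
    have h := congrArg norm hderiv
    rw [norm_mul, hd, one_mul, hxr, hyr, Complex.norm_real, Complex.norm_real,
      Real.norm_of_nonneg hre'.le, Real.norm_of_nonneg hre.le] at h
    simpa using h
  have hy0 : y ≠ 0 := fun h => by rw [h] at hre; simp at hre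
  -- Both derivatives at 0 are positive and have equal modulus, so the rotation is trivial.
  have hd1 : d = 1 := by
    have h : y = d * y := by
      rw [← hderiv, hxr, hxy, ← hyr]
    exact mul_right_cancel₀ hy0 (by rw [← h, one_mul])
  intro z hz
  simp [heq hz, hd1]

end Factorization

/-- The relation on the values of the branches given by a partition. -/
def valueRel {f : ℂ → ℂ} (P : Set (Set (InvBranch f))) (p q : ℂ) : Prop :=
  ∃ g h : InvBranch f, g.value = p ∧ h.value = q ∧ ∃ A ∈ P, g ∈ A ∧ h ∈ A

/-- Invariance is where respect for the group enters: a path of pairs is realized by a loop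
permutation, which carries the common block to a block. -/
theorem isZeroFiberRel_valueRel (hf : IsSimpleBlaschke c s f) {P : Set (Set (InvBranch f))}
    (hP : IsRespectedPartition f P) : IsZeroFiberRel f (valueRel P) := by
  refine ⟨fun p hp hfp => ?_, fun p q => ?_, fun p q r => ?_, fun p q p' q' hp hp' hj => ?_⟩
  · obtain ⟨g, hg⟩ := hf.exists_branch hp hfp
    obtain ⟨A, ⟨hA, hgA⟩, -⟩ := hP.1.2 g
    exact ⟨g, g, hg, hg, A, hA, hgA, hgA⟩
  · rintro ⟨g, h, hg, hh, A, hA, hgA, hhA⟩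
    exact ⟨h, g, hh, hg, A, hA, hhA, hgA⟩
  · rintro ⟨g, h, hg, hh, A, hA, hgA, hhA⟩ ⟨h', k, hh', hk, B, hB, hhB, hkB⟩
    obtain rfl : h = h' := hf.value_injective (hh.trans hh'.symm)
    obtain rfl : A = B := (hP.1.2 h).unique ⟨hA, hhA⟩ ⟨hB, hhB⟩
    exact ⟨g, k, hg, hk, A, hA, hgA, hkB⟩
  · rintro ⟨g, h, hg, hh, A, hA, hgA, hhA⟩
    obtain ⟨σ, hσ, h1, h2⟩ := hf.exists_isLoopPerm hp hp' hj
    exact ⟨σ g, σ h, h1 g hg, h2 h hh, σ '' A, hP.2 σ (Subgroup.subset_closure hσ) A hA,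
      mem_image_of_mem σ hgA, mem_image_of_mem σ hhA⟩

theorem valueRel_iff (hf : IsSimpleBlaschke c s f) {P : Set (Set (InvBranch f))}
    (g h : InvBranch f) : valueRel P g.value h.value ↔ ∃ A ∈ P, g ∈ A ∧ h ∈ A := by
  constructor
  · rintro ⟨g', h', hg, hh, hA⟩
    obtain rfl := hf.value_injective hg
    obtain rfl := hf.value_injective hh
    exact hA
  · exact fun hA => ⟨g, h, rfl, rfl, hA⟩

/-- A respected partition gives a factorization with right factor `blaschkeOf P`, whose partition
is `P`. -/
theorem exists_factorization (hf : IsSimpleBlaschke c s f) {P : Set (Set (InvBranch f))}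
    (hP : IsRespectedPartition f P) :
    ∃ e t c' s' J, t ≠ 0 ∧ s' ≠ 0 ∧ IsBlaschkeWith e t (blaschkeOf P) ∧
      VanishesWithPosDeriv (blaschkeOf P) ∧ IsBlaschkeWith c' s' J ∧
      EqOn f (J ∘ blaschkeOf P) (ball 0 1) ∧ partitionOf f (blaschkeOf P) = P := by
  have hS := hf.isZeroFiberRel_valueRel hP
  obtain ⟨d, t, b, hb, hnd, htmem, hfib, hbS⟩ :=
    hf.exists_of_isZeroFiberRel hf.map_zero hf.simple hS
  have h0t : (0 : ℂ) ∈ t := (htmem 0).mpr ⟨by simp, hf.map_zero, hS.refl 0 (by simp) hf.map_zero⟩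
  have ht0 : t ≠ 0 := fun h => by simp [h] at h0t
  have hval : InvBranch.value '' zeroBlock P = {a | a ∈ t} := by
    have hmem : ∀ h, h ∈ zeroBlock P ↔ valueRel P 0 h.value := by
      intro h
      constructor
      · rintro ⟨A, hA, hhA, g, hgA, hg⟩
        exact ⟨g, h, hg, rfl, A, hA, hgA, hhA⟩
      · rintro ⟨g, h', hg, hh, A, hA, hgA, hhA⟩
        obtain rfl := hf.value_injective hh
        exact ⟨A, hA, hhA, g, hgA, hg⟩
    rw [hf.image_value _ hmem]
    ext a
    rw [mem_ofPred_eq, mem_ofPred_eq, htmem, and_assoc]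
  obtain ⟨⟨e, he⟩, hnorm⟩ := hf.blaschkeOf_spec hnd h0t hval
  have hiff : ∀ z ∈ ball (0 : ℂ) 1, ∀ z' ∈ ball (0 : ℂ) 1,
      (blaschkeOf P z = blaschkeOf P z' ↔ b z = b z') := by
    intro z hz z' hz'
    have hd0 : d ≠ 0 := norm_ne_zero_iff.mp (by rw [hb.norm_const]; norm_num)
    have he0 : e ≠ 0 := norm_ne_zero_iff.mp (by rw [he.norm_const]; norm_num)
    rw [hb.eq_on z hz, hb.eq_on z' hz', he.eq_on z hz, he.eq_on z' hz', mul_right_inj' hd0,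
      mul_right_inj' he0]
  obtain ⟨c', s', J, hJ, hfJ⟩ := hf.exists_factor he ht0 fun z hz z' hz' h =>
    hfib z hz z' hz' ((hiff z hz z' hz').mp h)
  -- Without zeros `J` would have modulus 1, but it vanishes at the image of 0.
  have hs' : s' ≠ 0 := by
    rintro rfl
    have h2 := hJ.norm_eq (he.mem_ball ht0 (z := 0) (by simp))
    rw [← hfJ 0 (by simp), hf.map_zero] at h2
    simp at h2
  have hcomp : EqOn f (J ∘ blaschkeOf P) (ball 0 1) := fun z hz => hfJ z hz
  refine ⟨e, t, c', s', J, ht0, hs', he, hnorm, hJ, hcomp, ?_⟩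
  have hblock : ∀ A ∈ P, ∀ g ∈ A, {h : InvBranch f | h.comp (blaschkeOf P) =
      g.comp (blaschkeOf P)} = A := by
    intro A hA g hgA
    ext h
    rw [mem_ofPred_eq, hf.comp_eq_comp_iff hJ he ht0 hcomp,
      hiff _ h.value_mem _ g.value_mem,
      hbS _ h.value_mem _ g.value_mem h.apply_value g.apply_value, hf.valueRel_iff]
    constructor
    · rintro ⟨B, hB, hhB, hgB⟩
      rwa [(hP.1.2 g).unique ⟨hA, hgA⟩ ⟨hB, hgB⟩]
    · exact fun hhA => ⟨A, hA, hhA, hgA⟩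
  ext A
  constructor
  · rintro ⟨g, rfl⟩
    obtain ⟨A, ⟨hA, hgA⟩, -⟩ := hP.1.2 g
    rwa [hblock A hA g hgA]
  · intro hA
    obtain ⟨g, hg⟩ : A.Nonempty := nonempty_iff_ne_empty.mpr fun h => hP.1.1 (h ▸ hA)
    exact ⟨g, (hblock A hA g hg).symm⟩

end IsSimpleBlaschke

end

/-! ### The correspondence between partitions and factorizations -/

theorem theorem3p1 (n : ℕ) (I : ℂ → ℂ) (hI : IsFiniteBlaschke n I) (hI0 : I 0 = 0)
    (hsimple : ∀ a ∈ ball (0 : ℂ) 1, I a = 0 → deriv I a ≠ 0) :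
    -- there are `n` branches
    Nat.card (InvBranch I) = n ∧
    -- partitions give factorizations
    (∀ P : Set (Set (InvBranch I)), IsRespectedPartition I P →
      ∃ k m : ℕ, HasPartitionOrder P k ∧
        IsFiniteBlaschke k (blaschkeOf P) ∧ VanishesWithPosDeriv (blaschkeOf P) ∧
        ∃ J : ℂ → ℂ, IsFiniteBlaschke m J ∧
          EqOn I (J ∘ blaschkeOf P) (ball (0 : ℂ) 1)) ∧
    -- factorizations give partitions
    (∀ (m k : ℕ) (J b : ℂ → ℂ), IsFiniteBlaschke m J → IsFiniteBlaschke k b →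
      EqOn I (J ∘ b) (ball (0 : ℂ) 1) →
        IsRespectedPartition I (partitionOf I b) ∧ HasPartitionOrder (partitionOf I b) k) ∧
    -- the partition of the factorization given by `P` is `P`
    (∀ P : Set (Set (InvBranch I)), IsRespectedPartition I P →
      partitionOf I (blaschkeOf P) = P) ∧
    -- the right factor given by the partition of `b` is `b`, up to a disk automorphism, and
    -- exactly `b` if `b` is normalized
    (∀ (m k : ℕ) (J b : ℂ → ℂ), IsFiniteBlaschke m J → IsFiniteBlaschke k b →
      EqOn I (J ∘ b) (ball (0 : ℂ) 1) →
        (∃ φ : ℂ → ℂ, IsFiniteBlaschke 1 φ ∧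
          EqOn b (φ ∘ blaschkeOf (partitionOf I b)) (ball (0 : ℂ) 1)) ∧
        (VanishesWithPosDeriv b →
          EqOn (blaschkeOf (partitionOf I b)) b (ball (0 : ℂ) 1))) := by
  obtain ⟨-, c, s, rfl, hIs⟩ := isFiniteBlaschke_iff.mp hI
  have hf : IsSimpleBlaschke c s I := ⟨hIs, hI0, hsimple⟩
  have hne : ∀ {s : Multiset ℂ}, 0 < Multiset.card s → s ≠ 0 := Multiset.card_pos.mp
  refine ⟨hf.card_branches, fun P hP => ?_, fun m k J b hJ hb hcomp => ?_, fun P hP => ?_,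
    fun m k J b hJ hb hcomp => ?_⟩
  · obtain ⟨e, t, c', s', J, ht, hs', he, hnorm, hJ, hcomp, hpart⟩ := hf.exists_factorization hP
    refine ⟨Multiset.card t, Multiset.card s', ?_,
      isFiniteBlaschke_iff.mpr ⟨Multiset.card_pos.mpr ht, e, t, rfl, he⟩, hnorm, J,
      isFiniteBlaschke_iff.mpr ⟨Multiset.card_pos.mpr hs', c', s', rfl, hJ⟩, hcomp⟩
    -- Equality of block sizes comes from the converse direction, as `P` is the partition of its own
    -- right factor.
    have h := hf.hasPartitionOrder_partitionOf hJ he ht hcomp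
    rwa [hpart] at h
  · obtain ⟨-, _, _, rfl, hJ'⟩ := isFiniteBlaschke_iff.mp hJ
    obtain ⟨hk, _, _, rfl, hb'⟩ := isFiniteBlaschke_iff.mp hb
    exact ⟨hf.isRespectedPartition_partitionOf hb',
      hf.hasPartitionOrder_partitionOf hJ' hb' (hne hk) hcomp⟩
  · obtain ⟨_, _, _, _, _, _, _, _, _, _, _, hpart⟩ := hf.exists_factorization hP
    exact hpart
  · obtain ⟨-, _, _, rfl, hJ'⟩ := isFiniteBlaschke_iff.mp hJ
    obtain ⟨hk, _, _, rfl, hb'⟩ := isFiniteBlaschke_iff.mp hb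
    exact ⟨hf.exists_automorphism hJ' hb' (hne hk) hcomp,
      hf.blaschkeOf_partitionOf_eq hJ' hb' (hne hk) hcomp⟩
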